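/- Let $\Phi_h$ be a Runge–Kutta method with real coefficients $a_{ij}, b_i$ ($1\le i,j\le s$): for a vector field $g$, $\Phi_{h,g}(y)=y+h\sum_i b_i g(v_i)$ with stages $v_i=y+h\sum_j a_{ij}g(v_j)$. Assume that it is consistent, i.e. $\sum_i b_i=1$. Let $\phi_{t,f}$ be the time-$t$ flow map of $\dot y=f(y)$. Equip $\mathbb C^D$ with the norm $\|\cdot\|=\|\cdot\|_\infty$ and let $\mathcal B(x,r)\subset\mathbb C^D$ be the open ball of radius $r$ about $x$. The inverse modified differential equation (IMDE) determined by $\Phi_h$ and $f$ is $\dot{\tilde y}=f_h(\tilde y)=\sum_{k\ge0}h^kf_k(\tilde y)$, where the $f_k$ are obtained recursively by comparing the coefficients of equal powers of $h$ in the formal power series identity $\Phi_{h,f_h}(y)=\phi_{h,f}(y)$. Its truncation is $f_h^K=\sum_{k=0}^Kh^kf_k$. **Theorem.** Let $S\ge1$ be an integer and $\rho_1,\rho_2>0$. There are constants $T_0,q,\gamma,c_1>0$ and a function $h\mapsto K(h)\in\mathbb N$, depending only on $\rho_1$, $\rho_2$, $S$ and the coefficients of $\Phi_h$, such that the following holds.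 Let $D\in\mathbb N$, $x\in\mathbb R^D$ and $r_1,r_2,m>0$ with $r_1/m=\rho_1$ and $r_2/m=\rho_2$. Let the target field $f$ and the learned field $f_\theta$, with values in $\mathbb C^D$, be analytic on $\mathcal B(x,r_1+r_2)$ and bounded there by $m$ in norm. Let $0<T<T_0$ and $h=T/S$. Then for every $y\in\mathcal B(x,r_1)$ the $S$ successive steps of $(\Phi_{h,f_\theta})^S(y)$ are well defined (each has exactly one family of stages in $\mathcal B(x,r_1+r_2)$), the solution $\phi_{t,f}(y)$ exists, is unique and stays in $\mathcal B(x,r_1+r_2)$ for $0\le t\le Sh$, the number $$\mathcal L=\frac1{Sh}\sup_{y\in\mathcal B(x,r_1)}\bigl\|(\Phi_{h,f_\theta})^S(y)-\phi_{Sh,f}(y)\bigr\|$$ is finite, and $$\bigl\|f_\theta(x)-f_h^{K(h)}(x)\bigr\|\le c_1\,m\,e^{-\gamma/h^{1/q}}+\frac{e}{e-1}\,\mathcal L .$$ -/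

import Mathlib

open Metric

noncomputable section

namespace IMDE

/-- The space `ℂ^D`; as a `Pi` type it carries the `l_∞` norm. -/
abbrev CVec (D : ℕ) : Type := Fin D → ℂ

/-- The point of `ℂ^D` given by a point of `ℝ^D`. -/
def ofRealVec {D : ℕ} (x : Fin D → ℝ) : CVec D := fun i => (x i : ℂ)

/-! ### Runge--Kutta methods -/

/-- A Runge--Kutta method with `s` stages, given by its real coefficients. -/
structure RungeKutta (s : ℕ) where
  a : Fin s → Fin s → ℝ
  b : Fin s → ℝ

namespace RungeKutta

variable {s D : ℕ}

/-- A method is consistent (of order at least one) if its weights sum to one. -/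
def Consistent (Φ : RungeKutta s) : Prop := ∑ i, Φ.b i = 1

/-- `v` is a family of internal stages, for the vector field `g` given on the set `U`, of one step
of size `h` that starts at `y`:  `v i = y + h ∑ j, a i j g (v j)`, all stages being in `U`. -/
def IsStages (Φ : RungeKutta s) (U : Set (CVec D)) (g : CVec D → CVec D) (h : ℝ) (y : CVec D)
    (v : Fin s → CVec D) : Prop :=
  ∀ i, v i ∈ U ∧ v i = y + h • ∑ j, Φ.a i j • g (v j)

open Classical in
/-- One step `Φ_{h,g}(y) = y + h ∑ i, b i g (v i)`, where `v` are the internal stages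
(the value `y` is used when the stage equations have no solution in `U`). -/
def step (Φ : RungeKutta s) (U : Set (CVec D)) (g : CVec D → CVec D) (h : ℝ) (y : CVec D) :
    CVec D :=
  if hv : ∃ v, Φ.IsStages U g h y v then y + h • ∑ i, Φ.b i • g (hv.choose i) else y

/-- The ODE solver: `S` compositions of the step of size `h`. -/
def solver (Φ : RungeKutta s) (U : Set (CVec D)) (g : CVec D → CVec D) (h : ℝ) (S : ℕ) :
    CVec D → CVec D :=
  (Φ.step U g h)^[S]

/-- All the `S` steps of the solver that start at `y` are well defined: at each of them the stage
equations have exactly one solution in `U`. -/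
def SolverDefinedAt (Φ : RungeKutta s) (U : Set (CVec D)) (g : CVec D → CVec D) (h : ℝ) (S : ℕ)
    (y : CVec D) : Prop :=
  ∀ n < S, ∃! v : Fin s → CVec D, Φ.IsStages U g h (Φ.solver U g h n y) v

end RungeKutta

/-! ### The flow -/

/-- `c` solves `c' = f(c)`, `c 0 = y` on `[0, t]` and remains in `U`. -/
def IsSolution {D : ℕ} (U : Set (CVec D)) (f : CVec D → CVec D) (t : ℝ) (y : CVec D)
    (c : ℝ → CVec D) : Prop :=
  c 0 = y ∧ ∀ τ ∈ Set.Icc 0 t, c τ ∈ U ∧ HasDerivWithinAt c (f (c τ)) (Set.Icc 0 t) τ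

open Classical in
/-- The time-`t` flow map `φ_{t,f}` (the value `y` is used when there is no solution in `U` up to
time `t`). -/
def flow {D : ℕ} (U : Set (CVec D)) (f : CVec D → CVec D) (t : ℝ) (y : CVec D) : CVec D :=
  if hc : ∃ c, IsSolution U f t y c then hc.choose t else y

/-- The flow is well defined at `y` up to time `t`: there is a solution on `[0, t]`, and any two
solutions agree on `[0, t]`. -/
def FlowDefinedAt {D : ℕ} (U : Set (CVec D)) (f : CVec D → CVec D) (t : ℝ) (y : CVec D) : Prop :=
  (∃ c, IsSolution U f t y c) ∧
    ∀ c c', IsSolution U f t y c → IsSolution U f t y c' → Set.EqOn c c' (Set.Icc 0 t)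

/-! ### The inverse modified differential equation

Formal power series in the step size `h` are handled through their coefficients.  A formal vector
field `f_h = ∑ k, h^k F k` is the sequence `F : ℕ → (CVec D → CVec D)`. -/

/-- The `n`-th Taylor coefficient at `0` of a curve in `ℂ^D`. -/
def taylorCoeff {D : ℕ} (n : ℕ) (c : ℂ → CVec D) : CVec D :=
  ((n.factorial : ℂ)⁻¹) • iteratedDeriv n c 0

/-- The Lie derivative `g ↦ g' f` along `f`. -/
def lieDeriv {D : ℕ} (f g : CVec D → CVec D) : CVec D → CVec D :=
  fun y => fderiv ℂ g y (f y)

/-- The coefficient of `h^n` in the Taylor series of the exact solution `φ_{h,f}(y)`: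
`1/n!` times the `n`-fold Lie derivative of the identity. -/
def exactCoeff {D : ℕ} (f : CVec D → CVec D) (n : ℕ) (y : CVec D) : CVec D :=
  ((n.factorial : ℂ)⁻¹) • ((lieDeriv f)^[n] id) y

namespace RungeKutta

variable {s D : ℕ}

/-- The formal stages `V i = y + h ∑ j, a i j f_h (V j)` for the formal vector field
`f_h = ∑ k, h^k F k`, truncated after the power `h^n` (a polynomial in `h`).  The coefficient of
`h^(n+1)` in `V i` is `∑ j, a i j` times the coefficient of `h^n` in `f_h (V j)`, which involves
only the powers up to `h^n` in `f_h` and `V j`. -/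
def formalStage (Φ : RungeKutta s) (F : ℕ → CVec D → CVec D) (y : CVec D) :
    ℕ → ℂ → Fin s → CVec D
  | 0, _, _ => y
  | n + 1, h, i => formalStage Φ F y n h i + h ^ (n + 1) • ∑ j, Φ.a i j •
      taylorCoeff n (fun τ => ∑ k ∈ Finset.range (n + 1), τ ^ k • F k (formalStage Φ F y n τ j))

/-- The coefficient of `h^(n+1)` in the formal expansion of the numerical solution
`Φ_{h,f_h}(y) = y + h ∑ i, b i f_h (V i)` for the formal vector field `f_h = ∑ k, h^k F k`. -/
def numCoeffSucc (Φ : RungeKutta s) (F : ℕ → CVec D → CVec D) (n : ℕ) (y : CVec D) : CVec D :=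
  ∑ i, Φ.b i •
    taylorCoeff n (fun τ => ∑ k ∈ Finset.range (n + 1), τ ^ k • F k (Φ.formalStage F y n τ i))

/-- The first `n` coefficients `f_0, …, f_{n-1}` of the inverse modified vector field (followed by
zeros), obtained by comparing coefficients in `Φ_{h,f_h}(y) = φ_{h,f}(y)`.  For a consistent method
the coefficient of `h^(n+1)` on the left is `f_n` plus the coefficient of `h^(n+1)` in
`Φ_{h,g}(y)` with `g = f_0 + ⋯ + h^(n-1) f_{n-1}`, which determines `f_n`. -/
def imdeList (Φ : RungeKutta s) (f : CVec D → CVec D) : ℕ → (ℕ → CVec D → CVec D)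
  | 0 => fun _ _ => 0
  | n + 1 => Function.update (imdeList Φ f n) n
      (fun y => exactCoeff f (n + 1) y - Φ.numCoeffSucc (imdeList Φ f n) n y)

/-- The coefficient `f_k` of `h^k` in the inverse modified differential equation determined by
`Φ` and `f`. -/
def imdeCoeff (Φ : RungeKutta s) (f : CVec D → CVec D) (k : ℕ) : CVec D → CVec D :=
  Φ.imdeList f (k + 1) k

/-- The truncated vector field `f_h^K = ∑ k ≤ K, h^k f_k`. -/
def imdeTrunc (Φ : RungeKutta s) (f : CVec D → CVec D) (h : ℝ) (K : ℕ) (y : CVec D) : CVec D :=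
  ∑ k ∈ Finset.range (K + 1), h ^ k • Φ.imdeCoeff f k y

end RungeKutta

/-! ### The learning loss -/

/-- The error `‖(Φ_{h,g})^S(y) - φ_{Sh,f}(y)‖` of the learned field `g` at `y`. -/
def pointLoss {s D : ℕ} (Φ : RungeKutta s) (U : Set (CVec D)) (f g : CVec D → CVec D)
    (h : ℝ) (S : ℕ) (y : CVec D) : ℝ :=
  ‖Φ.solver U g h S y - flow U f (S * h) y‖

/-- The learning loss: the supremum of the error over the complex ball `B(x, r₁)`, divided
by `S h`. -/
def loss {s D : ℕ} (Φ : RungeKutta s) (U : Set (CVec D)) (f g : CVec D → CVec D)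
    (h : ℝ) (S : ℕ) (x : CVec D) (r₁ : ℝ) : ℝ :=
  (⨆ y : ball x r₁, pointLoss Φ U f g h S y) / (S * h)

end IMDE

end

/-!
The learned field is compared with the truncated inverse modified field through an iteration that
works with the whole function `τ ↦ f_τ` on a disc of complex step sizes, rather than with its
formal coefficients one by one. Starting from `G = 0`, a field `G τ` is replaced by

  `G τ y - (Φ_{τ, G τ}^S y - φ_{Sτ, f} y) / (S τ)`   (`RungeKutta.correction`).

Three properties of this correction carry the proof, each on balls whose radius decreases by `δ` at
every step, for `|τ| < ε` with `ε` a small multiple of `δ / m`.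

* It preserves the bound `2 m` and holomorphy in `(τ, y)` (`norm_correction_le`,
  `holomorphicFamily_correction`). By consistency the correction only sees differences of values
  of `G τ` along an orbit, and these are controlled by Cauchy's estimate.
* It contracts the distance to the learned field by the factor `1 / e`, up to the error of the
  solver (`norm_sub_correction_le`), since two fields that differ by `b` have orbits which after `S`
  steps differ by `S τ` times the difference of the fields, up to a small multiple of `S τ b`
  (`norm_orbit_sub_le`). Summing the geometric series gives the factor `e / (e - 1)` of the loss.
* It improves the agreement with the inverse modified field from `O(τ ^ n)` to `O(τ ^ (n + 1))`
  (`isBigO_correction_sub`), because the formal stages and the Taylor polynomial of the flow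
  satisfy the defining relations of the method up to higher order
  (`isBigO_formalStage`, `isBigO_formal_sub_exact`, `IsSolution.norm_sub_exact_le`).

After `N` steps the Taylor polynomial at `τ = 0` of the iterate is the truncated inverse modified
field at `x`. The iterate is bounded by `2 m` for `|τ| < ε`, so at `τ = h ≤ ε / e` the Taylor
remainder is `O(m e ^ (-N))`. The domain allows `δ` proportional to `m / N`, hence `ε` proportional
to `1 / N`, so that `N` may be taken proportional to `1 / h`; the exponent is `q = 1`.

Holomorphic dependence on `(τ, y)` is only tested on holomorphic curves, so functions of one complex
variable suffice: the stages are uniform limits of fixed point iterations, and the flow is a uniform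
limit of Euler's method.
-/

namespace IMDE

open Filter Topology Asymptotics

/-! ### Holomorphy along curves -/

section HolomorphicAlongCurves

variable {E F : Type*} [NormedAddCommGroup E] [NormedSpace ℂ E] [NormedAddCommGroup F]
  [NormedSpace ℂ F]

/-- `g` is holomorphic along every holomorphic curve in `V`. For the functions considered here this
is equivalent to holomorphy on the open set `V`, but it only involves functions of one complex
variable, and it is visibly stable under composition and under uniform limits. -/
def HolomorphicAlong (V : Set E) (g : E → F) : Prop :=
  ∀ (W : Set ℂ) (u : ℂ → E), IsOpen W → DifferentiableOn ℂ u W → (∀ t ∈ W, u t ∈ V) →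
    DifferentiableOn ℂ (fun t => g (u t)) W

/-- The family `τ ↦ G τ` of maps on `V`, with parameter `τ` in the disc of radius `ε`, is jointly
holomorphic in the sense of `HolomorphicAlong`. -/
def HolomorphicFamily (ε : ℝ) (V : Set E) (G : ℂ → E → F) : Prop :=
  ∀ (W : Set ℂ) (τ : ℂ → ℂ) (u : ℂ → E), IsOpen W → DifferentiableOn ℂ τ W →
    DifferentiableOn ℂ u W → (∀ t ∈ W, τ t ∈ ball (0 : ℂ) ε) → (∀ t ∈ W, u t ∈ V) →
      DifferentiableOn ℂ (fun t => G (τ t) (u t)) W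

theorem HolomorphicAlong.mono {V V' : Set E} {g : E → F} (hg : HolomorphicAlong V g)
    (h : V' ⊆ V) : HolomorphicAlong V' g :=
  fun W u hW hu huV => hg W u hW hu fun t ht => h (huV t ht)

theorem HolomorphicFamily.holomorphicAlong {ε : ℝ} {V : Set E} {G : ℂ → E → F}
    (hG : HolomorphicFamily ε V G) {τ : ℂ} (hτ : τ ∈ ball (0 : ℂ) ε) :
    HolomorphicAlong V (G τ) :=
  fun W u hW hu huV =>
    hG W (fun _ => τ) u hW (differentiableOn_const τ) hu (fun _ _ => hτ) huV

theorem HolomorphicFamily.differentiableOn {ε : ℝ} {V : Set E} {G : ℂ → E → F}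
    (hG : HolomorphicFamily ε V G) {y : E} (hy : y ∈ V) :
    DifferentiableOn ℂ (fun τ => G τ y) (ball (0 : ℂ) ε) :=
  hG (ball 0 ε) id (fun _ => y) isOpen_ball differentiableOn_id (differentiableOn_const y)
    (fun _ ht => ht) (fun _ _ => hy)

theorem HolomorphicAlong.sub {V : Set E} {g g' : E → F} (hg : HolomorphicAlong V g)
    (hg' : HolomorphicAlong V g') : HolomorphicAlong V (fun y => g y - g' y) :=
  fun W u hW hu huV => (hg W u hW hu huV).sub (hg' W u hW hu huV)

theorem HolomorphicAlong.const_smul {V : Set E} {g : E → F} (hg : HolomorphicAlong V g)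
    (c : ℂ) : HolomorphicAlong V (fun y => c • g y) :=
  fun W u hW hu huV => (hg W u hW hu huV).const_smul c

theorem _root_.AnalyticOnNhd.holomorphicAlong {V : Set E} {g : E → F}
    (hg : AnalyticOnNhd ℂ g V) : HolomorphicAlong V g :=
  fun _ _ _ hu huV => hg.differentiableOn.comp hu huV

/-- Cauchy's estimate in Lipschitz form. -/
theorem HolomorphicAlong.norm_sub_le {y : E} {δ M : ℝ} {g : E → F}
    (hg : HolomorphicAlong (ball y δ) g) (hM : ∀ u ∈ ball y δ, ‖g u‖ ≤ M)
    {u w : E} (hu : u ∈ ball y (δ / 2)) (hw : w ∈ ball y (δ / 2)) :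
    ‖g u - g w‖ ≤ 4 * M / δ * ‖u - w‖ := by
  have hδ : 0 < δ := by
    have := pos_of_mem_ball hu
    linarith
  have hu' : u ∈ ball y δ := ball_subset_ball (by linarith) hu
  have hw' : w ∈ ball y δ := ball_subset_ball (by linarith) hw
  have hM0 : 0 ≤ M := (norm_nonneg _).trans (hM u hu')
  have hdiff : ‖g u - g w‖ ≤ 2 * M := by
    have := _root_.norm_sub_le (g u) (g w)
    linarith [hM u hu', hM w hw']
  rcases eq_or_ne u w with rfl | huw
  · simp
  have hn : 0 < ‖u - w‖ := norm_pos_iff.2 (sub_ne_zero.2 huw)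
  rcases le_or_gt (δ / 2) ‖u - w‖ with hfar | hnear
  · -- distant points: the trivial bound `2 * M` suffices
    calc ‖g u - g w‖ ≤ 2 * M := hdiff
      _ = 4 * M / δ * (δ / 2) := by field_simp; ring
      _ ≤ 4 * M / δ * ‖u - w‖ := by gcongr
  · set R := δ / 2 / ‖u - w‖ with hR
    have hR1 : 1 < R := by rw [hR, lt_div_iff₀ hn]; linarith
    have hline : ∀ t ∈ ball (0 : ℂ) R, w + t • (u - w) ∈ ball y δ := by
      intro t ht
      have h1 : ‖t‖ * ‖u - w‖ < δ / 2 := by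
        rw [mem_ball_zero_iff, hR, lt_div_iff₀ hn] at ht
        exact ht
      rw [mem_ball_iff_norm] at hw ⊢
      calc ‖w + t • (u - w) - y‖ = ‖(w - y) + t • (u - w)‖ := by congr 1; abel
        _ ≤ ‖w - y‖ + ‖t‖ * ‖u - w‖ := by
          rw [← norm_smul]
          exact norm_add_le _ _
        _ < δ := by linarith
    have hd : DifferentiableOn ℂ (fun t : ℂ => g (w + t • (u - w))) (ball 0 R) :=
      hg (ball 0 R) (fun t => w + t • (u - w)) isOpen_ball
        ((differentiable_id.smul_const _).const_add _).differentiableOn hline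
    have hmaps : Set.MapsTo (fun t : ℂ => g (w + t • (u - w))) (ball 0 R)
        (closedBall ((fun t : ℂ => g (w + t • (u - w))) 0) (2 * M)) := by
      intro t ht
      rw [mem_closedBall_iff_norm]
      have h0 := hline 0 (mem_ball_self (by linarith))
      have := _root_.norm_sub_le (g (w + t • (u - w))) (g (w + (0 : ℂ) • (u - w)))
      linarith [hM _ (hline t ht), hM _ h0]
    have h1 : (1 : ℂ) ∈ ball (0 : ℂ) R := by simpa using hR1
    have := Complex.dist_le_div_mul_dist_of_mapsTo_ball hd hmaps h1
    simp only [one_smul, zero_smul, add_zero, add_sub_cancel, dist_eq_norm, sub_zero,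
      norm_one, mul_one] at this
    calc ‖g u - g w‖ ≤ 2 * M / R := this
      _ = 4 * M / δ * ‖u - w‖ := by rw [hR]; field_simp; ring

end HolomorphicAlongCurves

/-! ### Taylor coefficients -/

section Taylor

variable {D : ℕ}

theorem norm_taylorCoeff_le {g : ℂ → CVec D} {ε M : ℝ} (hε : 0 < ε)
    (hg : DifferentiableOn ℂ g (ball 0 ε)) (hM : ∀ z ∈ ball (0 : ℂ) ε, ‖g z‖ ≤ M) (n : ℕ) :
    ‖taylorCoeff n g‖ ≤ M / ε ^ n := by
  have hR : ∀ R : ℝ, 0 < R → R < ε → ‖taylorCoeff n g‖ * R ^ n ≤ M := by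
    intro R hR0 hRε
    have hsub : closedBall (0 : ℂ) R ⊆ ball 0 ε := closedBall_subset_ball hRε
    have hd : DiffContOnCl ℂ g (ball 0 R) :=
      (hg.mono (by rwa [closure_ball _ hR0.ne'])).diffContOnCl
    have := Complex.norm_iteratedDeriv_le_of_forall_mem_sphere_norm_le n hR0 hd
      fun z hz => hM z (hsub (sphere_subset_closedBall hz))
    have hn : (0 : ℝ) < n.factorial := by exact_mod_cast n.factorial_pos
    rw [le_div_iff₀ (by positivity)] at this
    rw [taylorCoeff, norm_smul, norm_inv, Complex.norm_natCast]
    calc (n.factorial : ℝ)⁻¹ * ‖iteratedDeriv n g 0‖ * R ^ n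
        = (n.factorial : ℝ)⁻¹ * (‖iteratedDeriv n g 0‖ * R ^ n) := by ring
      _ ≤ (n.factorial : ℝ)⁻¹ * (n.factorial * M) := by gcongr
      _ = M := by field_simp
  rw [le_div_iff₀ (by positivity)]
  have ht : Tendsto (fun R : ℝ => ‖taylorCoeff n g‖ * R ^ n) (𝓝[<] ε)
      (𝓝 (‖taylorCoeff n g‖ * ε ^ n)) :=
    ((continuous_const.mul (continuous_pow n)).tendsto ε).mono_left nhdsWithin_le_nhds
  refine le_of_tendsto ht ?_
  filter_upwards [Ioo_mem_nhdsLT hε] with R hR'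
  exact hR R hR'.1 hR'.2

theorem norm_sub_taylor_le {g : ℂ → CVec D} {ε M : ℝ} (hg : DifferentiableOn ℂ g (ball 0 ε))
    (hM : ∀ z ∈ ball (0 : ℂ) ε, ‖g z‖ ≤ M) (N : ℕ) {z : ℂ} (hz : z ∈ ball (0 : ℂ) ε) :
    ‖g z - ∑ n ∈ Finset.range N, z ^ n • taylorCoeff n g‖ ≤
      M * (‖z‖ / ε) ^ N / (1 - ‖z‖ / ε) := by
  have hε : 0 < ε := pos_of_mem_ball hz
  have hz' : ‖z‖ / ε < 1 := by
    rw [div_lt_one hε]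
    simpa using hz
  have hs : HasSum (fun n => z ^ n • taylorCoeff n g) (g z) := by
    have := Complex.hasSum_taylorSeries_on_ball hg hz
    simp only [sub_zero] at this
    refine this.congr_fun fun n => ?_
    exact smul_comm _ _ _
  have htail : g z - ∑ n ∈ Finset.range N, z ^ n • taylorCoeff n g =
      ∑' n, z ^ (n + N) • taylorCoeff (n + N) g := by
    rw [← hs.tsum_eq, ← hs.summable.sum_add_tsum_nat_add N]
    abel
  have hgeo : HasSum (fun n : ℕ => M * (‖z‖ / ε) ^ N * (‖z‖ / ε) ^ n)
      (M * (‖z‖ / ε) ^ N * (1 - ‖z‖ / ε)⁻¹) :=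
    (hasSum_geometric_of_lt_one (by positivity) hz').mul_left _
  rw [htail, div_eq_mul_inv]
  refine tsum_of_norm_bounded hgeo fun n => ?_
  calc ‖z ^ (n + N) • taylorCoeff (n + N) g‖
      = ‖z‖ ^ (n + N) * ‖taylorCoeff (n + N) g‖ := by rw [norm_smul, norm_pow]
    _ ≤ ‖z‖ ^ (n + N) * (M / ε ^ (n + N)) := by
      gcongr
      exact norm_taylorCoeff_le hε hg hM _
    _ = M * (‖z‖ / ε) ^ N * (‖z‖ / ε) ^ n := by rw [div_pow, div_pow, pow_add, pow_add]; field_simp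

/-- Taylor's formula in the first variable, locally uniformly in the second one. -/
theorem isBigO_sub_taylor {H : ℂ × CVec D → CVec D} {x : CVec D} (hH : AnalyticAt ℂ H (0, x))
    (N : ℕ) :
    (fun p : ℂ × CVec D => H p - ∑ n ∈ Finset.range N,
      p.1 ^ n • taylorCoeff n (fun τ => H (τ, p.2))) =O[𝓝 (0, x)] fun p => p.1 ^ N := by
  have hb : ∀ᶠ p in 𝓝 ((0 : ℂ), x), AnalyticAt ℂ H p ∧ ‖H p‖ ≤ ‖H (0, x)‖ + 1 :=
    hH.eventually_analyticAt.and
      (hH.continuousAt.norm.eventually_le_const (lt_add_one ‖H (0, x)‖))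
  obtain ⟨r, hr, hball⟩ := Metric.eventually_nhds_iff_ball.1 hb
  have hmem : ∀ (τ : ℂ) (y : CVec D), τ ∈ ball (0 : ℂ) r → y ∈ ball x r →
      (τ, y) ∈ ball ((0 : ℂ), x) r := by
    intro τ y hτ hy
    rw [← ball_prod_same]
    exact ⟨hτ, hy⟩
  refine IsBigO.of_bound ((‖H (0, x)‖ + 1) * (1 / r) ^ N * 2) ?_
  filter_upwards [Metric.ball_mem_nhds ((0 : ℂ), x) (half_pos hr)] with p hp
  rw [← ball_prod_same] at hp
  have hp1 : ‖p.1‖ < r / 2 := by simpa using hp.1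
  have hp2 : p.2 ∈ ball x r := ball_subset_ball (by linarith) hp.2
  have hd : DifferentiableOn ℂ (fun τ => H (τ, p.2)) (ball 0 r) := by
    intro τ hτ
    have h1 : DifferentiableAt ℂ H (τ, p.2) := (hball _ (hmem τ p.2 hτ hp2)).1.differentiableAt
    exact (h1.comp τ (f := fun τ => (τ, p.2)) (by fun_prop)).differentiableWithinAt
  have hz : p.1 ∈ ball (0 : ℂ) r := by
    rw [mem_ball_zero_iff]
    linarith
  have := norm_sub_taylor_le hd (fun τ hτ => (hball _ (hmem τ p.2 hτ hp2)).2) N hz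
  refine this.trans ?_
  have h2 : (1 - ‖p.1‖ / r)⁻¹ ≤ 2 := by
    rw [inv_le_comm₀ _ two_pos]
    · have : ‖p.1‖ / r ≤ 1 / 2 := by rw [div_le_iff₀ hr]; linarith
      linarith
    · rw [sub_pos, div_lt_one hr]; linarith
  rw [norm_pow, div_eq_mul_inv]
  calc (‖H (0, x)‖ + 1) * (‖p.1‖ / r) ^ N * (1 - ‖p.1‖ / r)⁻¹
      ≤ (‖H (0, x)‖ + 1) * (‖p.1‖ / r) ^ N * 2 := by gcongr
    _ = (‖H (0, x)‖ + 1) * (1 / r) ^ N * 2 * ‖p.1‖ ^ N := by rw [div_pow, div_pow, one_pow]; field_simp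

theorem analyticAt_taylorCoeff {H : ℂ × CVec D → CVec D} {x : CVec D}
    (hH : AnalyticAt ℂ H (0, x)) (n : ℕ) :
    AnalyticAt ℂ (fun y => taylorCoeff n (fun τ => H (τ, y))) x := by
  have key : ∀ n : ℕ, ∃ H' : ℂ × CVec D → CVec D, AnalyticAt ℂ H' (0, x) ∧
      ∀ᶠ p in 𝓝 ((0 : ℂ), x), iteratedDeriv n (fun τ => H (τ, p.2)) p.1 = H' p := by
    intro n
    induction n with
    | zero => exact ⟨H, hH, by simp⟩
    | succ n ih =>
      obtain ⟨H', hH', heq⟩ := ih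
      refine ⟨fun p => fderiv ℂ H' p (1, 0), ?_, ?_⟩
      · exact (ContinuousLinearMap.apply ℂ (CVec D) ((1 : ℂ), (0 : CVec D))).analyticAt _ |>.comp
          hH'.fderiv
      · filter_upwards [heq.eventually_nhds, hH'.eventually_analyticAt] with p hp hpa
        have hc : ContinuousAt (fun τ : ℂ => (τ, p.2)) p.1 := by fun_prop
        have he : iteratedDeriv n (fun τ => H (τ, p.2)) =ᶠ[𝓝 p.1] fun τ => H' (τ, p.2) :=
          hc.eventually hp
        rw [iteratedDeriv_succ, he.deriv_eq]
        have hf : HasDerivAt (fun τ : ℂ => (τ, p.2)) ((1 : ℂ), (0 : CVec D)) p.1 :=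
          (hasDerivAt_id p.1).prodMk (hasDerivAt_const p.1 p.2)
        exact (hpa.differentiableAt.hasFDerivAt.comp_hasDerivAt p.1 hf).deriv
  obtain ⟨H', hH', heq⟩ := key n
  have hc : AnalyticAt ℂ (fun y : CVec D => ((0 : ℂ), y)) x := by fun_prop
  have h1 : AnalyticAt ℂ (fun y => H' (0, y)) x := hH'.comp hc
  have h2 : AnalyticAt ℂ (fun y => ((n.factorial : ℂ)⁻¹) • H' (0, y)) x := by fun_prop
  refine h2.congr ?_
  have := hc.continuousAt.eventually heq
  filter_upwards [this] with y hy
  exact congrArg _ hy.symm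

/-- An analytic function that is `O(z ^ N)` has vanishing derivatives of order below `N`. -/
theorem iteratedDeriv_eq_zero_of_isBigO {d : ℂ → CVec D} (hd : AnalyticAt ℂ d 0) {N : ℕ}
    (hO : d =O[𝓝 0] fun z => z ^ N) : ∀ j < N, iteratedDeriv j d 0 = 0 := by
  rw [← natCast_le_analyticOrderAt_iff_iteratedDeriv_eq_zero hd]
  by_contra! hlt
  obtain ⟨j, hj⟩ := ENat.ne_top_iff_exists.1 hlt.ne_top
  rw [← hj, Nat.cast_lt] at hlt
  obtain ⟨g, hg, hg0, hgd⟩ := (hd.analyticOrderAt_eq_natCast).1 hj.symm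
  apply hg0
  obtain ⟨C, hC⟩ := hO.bound
  have hle : ∀ᶠ z in 𝓝[≠] (0 : ℂ), ‖g z‖ ≤ C * ‖z‖ ^ (N - j) := by
    filter_upwards [hgd.filter_mono nhdsWithin_le_nhds, hC.filter_mono nhdsWithin_le_nhds,
      self_mem_nhdsWithin] with z h1 h2 hz
    have hz0 : 0 < ‖z‖ := norm_pos_iff.2 hz
    rw [h1, sub_zero, norm_smul, norm_pow, norm_pow, ← Nat.sub_add_cancel hlt.le,
      pow_add, ← mul_assoc, mul_comm] at h2
    exact le_of_mul_le_mul_right h2 (by positivity)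
  have ht0 : Tendsto (fun z : ℂ => C * ‖z‖ ^ (N - j)) (𝓝[≠] 0) (𝓝 0) := by
    have : Continuous fun z : ℂ => C * ‖z‖ ^ (N - j) := by fun_prop
    have h := this.tendsto 0
    rw [norm_zero, zero_pow (by omega), mul_zero] at h
    exact h.mono_left nhdsWithin_le_nhds
  have htg : Tendsto g (𝓝[≠] 0) (𝓝 (g 0)) := hg.continuousAt.tendsto.mono_left nhdsWithin_le_nhds
  exact tendsto_nhds_unique htg (squeeze_zero_norm' hle ht0)

theorem iteratedDeriv_sum_pow_smul (c : ℕ → CVec D) (N : ℕ) {j : ℕ} (hj : j < N) :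
    iteratedDeriv j (fun z : ℂ => ∑ n ∈ Finset.range N, z ^ n • c n) 0 =
      (j.factorial : ℂ) • c j := by
  rw [iteratedDeriv_fun_sum (fun n _ => by fun_prop)]
  rw [Finset.sum_eq_single j]
  · rw [iteratedDeriv_smul_const (by fun_prop), iteratedDeriv_fun_pow_zero]
    simp
  · intro n _ hn
    rw [iteratedDeriv_smul_const (by fun_prop), iteratedDeriv_fun_pow_zero]
    simp [hn.symm]
  · intro h
    exact absurd (Finset.mem_range.2 hj) h

theorem taylorCoeff_eq_of_isBigO {g : ℂ → CVec D} (hg : AnalyticAt ℂ g 0) {N : ℕ}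
    {c : ℕ → CVec D}
    (hO : (fun z : ℂ => g z - ∑ n ∈ Finset.range N, z ^ n • c n) =O[𝓝 0] fun z => z ^ N)
    {j : ℕ} (hj : j < N) : taylorCoeff j g = c j := by
  have hp : AnalyticAt ℂ (fun z : ℂ => ∑ n ∈ Finset.range N, z ^ n • c n) 0 := by fun_prop
  have h := iteratedDeriv_eq_zero_of_isBigO (hg.fun_sub hp) hO j hj
  rw [iteratedDeriv_fun_sub hg.contDiffAt hp.contDiffAt, sub_eq_zero,
    iteratedDeriv_sum_pow_smul c N hj] at h
  have : (j.factorial : ℂ) ≠ 0 := by exact_mod_cast j.factorial_ne_zero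
  rw [taylorCoeff, h, smul_smul, inv_mul_cancel₀ this, one_smul]

theorem taylorCoeff_congr_of_isBigO {g g' : ℂ → CVec D} (hg : AnalyticAt ℂ g 0)
    (hg' : AnalyticAt ℂ g' 0) {n : ℕ}
    (hO : (fun z => g z - g' z) =O[𝓝 0] fun z : ℂ => z ^ (n + 1)) :
    taylorCoeff n g = taylorCoeff n g' := by
  have h := iteratedDeriv_eq_zero_of_isBigO (hg.fun_sub hg') hO n (Nat.lt_succ_self n)
  rw [iteratedDeriv_fun_sub hg.contDiffAt hg'.contDiffAt, sub_eq_zero] at h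
  rw [taylorCoeff, taylorCoeff, h]

end Taylor

/-! ### Runge--Kutta steps -/

namespace RungeKutta

variable {s D : ℕ}

/-- A bound, at least `1`, for the row sums of `|a i j|` and for the sum of the `|b i|`. -/
def size (Φ : RungeKutta s) : ℝ := 1 + (∑ i, ∑ j, |Φ.a i j|) + ∑ i, |Φ.b i|

theorem one_le_size (Φ : RungeKutta s) : 1 ≤ Φ.size := by
  have h1 : 0 ≤ ∑ i, ∑ j, |Φ.a i j| := by positivity
  have h2 : 0 ≤ ∑ i, |Φ.b i| := by positivity
  rw [size]
  linarith

theorem norm_sum_a_le (Φ : RungeKutta s) (i : Fin s) {w : Fin s → CVec D} {C : ℝ} (hC : 0 ≤ C)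
    (hw : ∀ j, ‖w j‖ ≤ C) : ‖∑ j, Φ.a i j • w j‖ ≤ Φ.size * C := by
  have h2 : 0 ≤ ∑ i, |Φ.b i| := by positivity
  have h3 : ∑ j, |Φ.a i j| ≤ ∑ i, ∑ j, |Φ.a i j| :=
    Finset.single_le_sum (f := fun i => ∑ j, |Φ.a i j|) (fun i _ => by positivity)
      (Finset.mem_univ i)
  calc ‖∑ j, Φ.a i j • w j‖ ≤ ∑ j, |Φ.a i j| * C := by
        refine norm_sum_le_of_le _ fun j _ => ?_
        rw [norm_smul, Real.norm_eq_abs]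
        exact mul_le_mul_of_nonneg_left (hw j) (abs_nonneg _)
    _ = (∑ j, |Φ.a i j|) * C := by rw [Finset.sum_mul]
    _ ≤ Φ.size * C := by
      refine mul_le_mul_of_nonneg_right ?_ hC
      rw [size]
      linarith

theorem norm_sum_b_le (Φ : RungeKutta s) {w : Fin s → CVec D} {C : ℝ} (hC : 0 ≤ C)
    (hw : ∀ j, ‖w j‖ ≤ C) : ‖∑ j, Φ.b j • w j‖ ≤ Φ.size * C := by
  have h2 : 0 ≤ ∑ i, ∑ j, |Φ.a i j| := by positivity
  calc ‖∑ j, Φ.b j • w j‖ ≤ ∑ j, |Φ.b j| * C := by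
        refine norm_sum_le_of_le _ fun j _ => ?_
        rw [norm_smul, Real.norm_eq_abs]
        exact mul_le_mul_of_nonneg_left (hw j) (abs_nonneg _)
    _ = (∑ j, |Φ.b j|) * C := by rw [Finset.sum_mul]
    _ ≤ Φ.size * C := by
      refine mul_le_mul_of_nonneg_right ?_ hC
      rw [size]
      linarith

theorem isStages_smul_iff (Φ : RungeKutta s) (U : Set (CVec D)) (g : CVec D → CVec D) (h : ℝ)
    (y : CVec D) (v : Fin s → CVec D) :
    Φ.IsStages U (fun u => (h : ℂ) • g u) 1 y v ↔ Φ.IsStages U g h y v := by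
  simp only [IsStages, one_smul, Finset.smul_sum, Complex.coe_smul, smul_comm h]

theorem solver_smul (Φ : RungeKutta s) (U : Set (CVec D)) (g : CVec D → CVec D) (h : ℝ) (n : ℕ) :
    Φ.solver U (fun u => (h : ℂ) • g u) 1 n = Φ.solver U g h n := by
  have : Φ.step U (fun u => (h : ℂ) • g u) 1 = Φ.step U g h := by
    funext y
    have hs : Φ.IsStages U (fun u => (h : ℂ) • g u) 1 y = Φ.IsStages U g h y :=
      funext fun v => propext (Φ.isStages_smul_iff U g h y v)
    rw [step, step, hs]
    simp only [one_smul, Finset.smul_sum, Complex.coe_smul, smul_comm h]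
  rw [solver, solver, this]

theorem solverDefinedAt_smul_iff (Φ : RungeKutta s) (U : Set (CVec D)) (g : CVec D → CVec D)
    (h : ℝ) (n : ℕ) (y : CVec D) :
    Φ.SolverDefinedAt U (fun u => (h : ℂ) • g u) 1 n y ↔ Φ.SolverDefinedAt U g h n y := by
  simp only [SolverDefinedAt, solver_smul, isStages_smul_iff]

open Classical in
/-- The internal stages of a step of size one that starts at `y` (constant if there are none). -/
noncomputable def stages (Φ : RungeKutta s) (U : Set (CVec D)) (g : CVec D → CVec D) (y : CVec D) :
    Fin s → CVec D :=
  if hv : ∃ v, Φ.IsStages U g 1 y v then hv.choose else fun _ => y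

theorem isStages_stages {Φ : RungeKutta s} {U : Set (CVec D)} {g : CVec D → CVec D} {y : CVec D}
    (hv : ∃ v, Φ.IsStages U g 1 y v) : Φ.IsStages U g 1 y (Φ.stages U g y) := by
  rw [stages, dif_pos hv]
  exact hv.choose_spec

theorem step_eq {Φ : RungeKutta s} {U : Set (CVec D)} {g : CVec D → CVec D} {y : CVec D}
    (hv : ∃ v, Φ.IsStages U g 1 y v) :
    Φ.step U g 1 y = y + ∑ i, Φ.b i • g (Φ.stages U g y i) := by
  rw [step, stages, dif_pos hv, dif_pos hv, one_smul]

theorem solver_succ (Φ : RungeKutta s) (U : Set (CVec D)) (g : CVec D → CVec D) (h : ℝ) (n : ℕ)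
    (y : CVec D) : Φ.solver U g h (n + 1) y = Φ.step U g h (Φ.solver U g h n y) :=
  Function.iterate_succ_apply' _ _ _

/-- The map whose fixed points are the families of stages. -/
noncomputable def stageMap (Φ : RungeKutta s) (g : CVec D → CVec D) (y : CVec D) (v : Fin s → CVec D) :
    Fin s → CVec D :=
  fun i => y + ∑ j, Φ.a i j • g (v j)

theorem IsStages.stageMap_eq {Φ : RungeKutta s} {U : Set (CVec D)} {g : CVec D → CVec D}
    {y : CVec D} {v : Fin s → CVec D} (hv : Φ.IsStages U g 1 y v) : Φ.stageMap g y v = v := by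
  funext i
  rw [stageMap, ← one_smul ℝ (∑ j, Φ.a i j • g (v j))]
  exact (hv i).2.symm

theorem IsStages.norm_sub_le {Φ : RungeKutta s} {U : Set (CVec D)} {g : CVec D → CVec D}
    {y : CVec D} {v : Fin s → CVec D} (hv : Φ.IsStages U g 1 y v) {β : ℝ} (hβ : 0 ≤ β)
    (hg : ∀ u ∈ U, ‖g u‖ ≤ β) (i : Fin s) : ‖v i - y‖ ≤ Φ.size * β := by
  rw [(hv i).2, add_sub_cancel_left, one_smul]
  exact Φ.norm_sum_a_le i hβ fun j => hg _ (hv j).1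

section Contraction

variable {Φ : RungeKutta s} {U : Set (CVec D)} {g : CVec D → CVec D} {y : CVec D} {δ β : ℝ}

theorem mapsTo_stageMap (hδ : 0 < δ) (hβ : 0 ≤ β) (hyU : ball y δ ⊆ U)
    (hgβ : ∀ u ∈ U, ‖g u‖ ≤ β) (hsmall : 8 * (Φ.size * β) ≤ δ) :
    Set.MapsTo (Φ.stageMap g y) (closedBall (fun _ => y) (δ / 4))
      (closedBall (fun _ => y) (δ / 4)) := by
  intro v hv
  rw [closedBall_pi _ (by positivity), Set.mem_univ_pi] at hv ⊢
  intro i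
  rw [mem_closedBall_iff_norm, stageMap, add_sub_cancel_left]
  refine (Φ.norm_sum_a_le i hβ fun j => hgβ _ (hyU ?_)).trans (by linarith)
  exact closedBall_subset_ball (by linarith) (hv j)

theorem dist_stageMap_le (hδ : 0 < δ) (hβ : 0 ≤ β) (hyU : ball y δ ⊆ U)
    (hg : HolomorphicAlong (ball y δ) g) (hgβ : ∀ u ∈ U, ‖g u‖ ≤ β)
    (hsmall : 8 * (Φ.size * β) ≤ δ) {v w : Fin s → CVec D}
    (hv : v ∈ closedBall (fun _ => y) (δ / 4)) (hw : w ∈ closedBall (fun _ => y) (δ / 4)) :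
    dist (Φ.stageMap g y v) (Φ.stageMap g y w) ≤ 1 / 2 * dist v w := by
  rw [closedBall_pi _ (by positivity), Set.mem_univ_pi] at hv hw
  have hsub : closedBall y (δ / 4) ⊆ ball y (δ / 2) := closedBall_subset_ball (by linarith)
  rw [dist_pi_le_iff (by positivity)]
  intro i
  rw [dist_eq_norm, stageMap, stageMap, add_sub_add_left_eq_sub, ← Finset.sum_sub_distrib]
  simp_rw [← smul_sub]
  have hlip : ∀ j, ‖g (v j) - g (w j)‖ ≤ 4 * β / δ * dist v w := fun j => by
    refine (hg.norm_sub_le (fun u hu => hgβ u (hyU hu)) (hsub (hv j)) (hsub (hw j))).trans ?_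
    rw [← dist_eq_norm]
    exact mul_le_mul_of_nonneg_left (dist_le_pi_dist v w j) (by positivity)
  refine (Φ.norm_sum_a_le i (by positivity) hlip).trans ?_
  rw [← mul_assoc]
  refine mul_le_mul_of_nonneg_right ?_ dist_nonneg
  rw [mul_div_assoc', div_le_iff₀ hδ]
  linarith

/-- Every family of stages in `U` is close to `y`. -/
theorem IsStages.mem_closedBall {v : Fin s → CVec D} (hv : Φ.IsStages U g 1 y v) (hδ : 0 < δ)
    (hβ : 0 ≤ β) (hgβ : ∀ u ∈ U, ‖g u‖ ≤ β) (hsmall : 8 * (Φ.size * β) ≤ δ) :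
    v ∈ closedBall (fun _ => y) (δ / 4) := by
  rw [closedBall_pi _ (by positivity), Set.mem_univ_pi]
  intro i
  rw [mem_closedBall_iff_norm]
  linarith [hv.norm_sub_le hβ hgβ i]

theorem existsUnique_stages (hδ : 0 < δ) (hβ : 0 ≤ β) (hyU : ball y δ ⊆ U)
    (hg : HolomorphicAlong (ball y δ) g) (hgβ : ∀ u ∈ U, ‖g u‖ ≤ β)
    (hsmall : 8 * (Φ.size * β) ≤ δ) : ∃! v, Φ.IsStages U g 1 y v := by
  have hmaps := mapsTo_stageMap hδ hβ hyU hgβ hsmall (Φ := Φ)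
  have hcontr : ContractingWith (1 / 2)
      (hmaps.restrict (Φ.stageMap g y) (closedBall (fun _ => y) (δ / 4)) _) := by
    refine ⟨by rw [← NNReal.coe_lt_coe]; norm_num, LipschitzWith.of_dist_le_mul fun v w => ?_⟩
    have := dist_stageMap_le hδ hβ hyU hg hgβ hsmall v.2 w.2
    simpa [Subtype.dist_eq] using this
  obtain ⟨v, hvmem, hv, -⟩ := hcontr.exists_fixedPoint' isClosed_closedBall.isComplete
    hmaps (mem_closedBall_self (by positivity)) (edist_ne_top _ _)
  refine ⟨v, fun i => ⟨hyU ?_, ?_⟩, fun w hw => ?_⟩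
  · rw [closedBall_pi _ (by positivity), Set.mem_univ_pi] at hvmem
    exact closedBall_subset_ball (by linarith) (hvmem i)
  · rw [one_smul]
    exact (congrFun hv i).symm
  · have := dist_stageMap_le hδ hβ hyU hg hgβ hsmall
      (hw.mem_closedBall hδ hβ hgβ hsmall) hvmem
    rw [hw.stageMap_eq, hv] at this
    exact dist_le_zero.1 (by linarith)

theorem iterate_stageMap_mem (hδ : 0 < δ) (hβ : 0 ≤ β) (hyU : ball y δ ⊆ U)
    (hgβ : ∀ u ∈ U, ‖g u‖ ≤ β) (hsmall : 8 * (Φ.size * β) ≤ δ) (n : ℕ) :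
    (Φ.stageMap g y)^[n] (fun _ => y) ∈ closedBall (fun _ => y) (δ / 4) :=
  (mapsTo_stageMap hδ hβ hyU hgβ hsmall).iterate n (mem_closedBall_self (by positivity))

theorem dist_iterate_stageMap_le (hδ : 0 < δ) (hβ : 0 ≤ β) (hyU : ball y δ ⊆ U)
    (hg : HolomorphicAlong (ball y δ) g) (hgβ : ∀ u ∈ U, ‖g u‖ ≤ β)
    (hsmall : 8 * (Φ.size * β) ≤ δ) (n : ℕ) :
    dist ((Φ.stageMap g y)^[n] (fun _ => y)) (Φ.stages U g y) ≤ (1 / 2) ^ n * δ := by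
  have hs := isStages_stages (existsUnique_stages hδ hβ hyU hg hgβ hsmall (Φ := Φ)).exists
  have hmem := hs.mem_closedBall hδ hβ hgβ hsmall
  induction n with
  | zero =>
    rw [Function.iterate_zero_apply, dist_comm]
    rw [Metric.mem_closedBall] at hmem
    linarith
  | succ n ih =>
    rw [Function.iterate_succ_apply']
    have := dist_stageMap_le hδ hβ hyU hg hgβ hsmall
      (iterate_stageMap_mem hδ hβ hyU hgβ hsmall n) hmem
    rw [hs.stageMap_eq] at this
    rw [pow_succ]
    linarith

end Contraction

/-- The stages depend holomorphically on the vector field and on the initial value, being the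
uniform limit of the iterates of `stageMap`. -/
theorem differentiableOn_stages {Φ : RungeKutta s} {U : Set (CVec D)} {δ β ε : ℝ} (hδ : 0 < δ)
    (hβ : 0 ≤ β) {g : ℂ → CVec D → CVec D} (hg : HolomorphicFamily ε U g)
    (hgβ : ∀ τ ∈ ball (0 : ℂ) ε, ∀ u ∈ U, ‖g τ u‖ ≤ β) (hsmall : 8 * (Φ.size * β) ≤ δ)
    {W : Set ℂ} {τ : ℂ → ℂ} {y : ℂ → CVec D} (hW : IsOpen W) (hτ : DifferentiableOn ℂ τ W)
    (hy : DifferentiableOn ℂ y W) (hτε : ∀ t ∈ W, τ t ∈ ball (0 : ℂ) ε)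
    (hyU : ∀ t ∈ W, ball (y t) δ ⊆ U) (i : Fin s) :
    DifferentiableOn ℂ (fun t => Φ.stages U (g (τ t)) (y t) i) W := by
  have hmem : ∀ n, ∀ t ∈ W, ∀ j, (Φ.stageMap (g (τ t)) (y t))^[n] (fun _ => y t) j ∈ U := by
    intro n t ht j
    have := iterate_stageMap_mem hδ hβ (hyU t ht) (hgβ _ (hτε t ht)) hsmall n (Φ := Φ)
    rw [closedBall_pi _ (by positivity), Set.mem_univ_pi] at this
    exact hyU t ht (closedBall_subset_ball (by linarith) (this j))
  have hdiff : ∀ n, ∀ j, DifferentiableOn ℂ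
      (fun t => (Φ.stageMap (g (τ t)) (y t))^[n] (fun _ => y t) j) W := by
    intro n
    induction n with
    | zero => exact fun _ => hy
    | succ n ih =>
      intro j
      simp_rw [Function.iterate_succ_apply', stageMap]
      refine hy.add (DifferentiableOn.fun_sum fun k _ => ?_)
      exact (hg W τ _ hW hτ (ih k) hτε fun t ht => hmem n t ht k).const_smul (Φ.a j k)
  have hunif : TendstoUniformlyOn
      (fun n t => (Φ.stageMap (g (τ t)) (y t))^[n] (fun _ => y t) i)
      (fun t => Φ.stages U (g (τ t)) (y t) i) atTop W := by
    rw [Metric.tendstoUniformlyOn_iff]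
    intro η hη
    have h0 : Tendsto (fun n : ℕ => (1 / 2 : ℝ) ^ n * δ) atTop (𝓝 0) := by
      have := (tendsto_pow_atTop_nhds_zero_of_lt_one (r := (1 / 2 : ℝ)) (by norm_num)
        (by norm_num)).mul_const δ
      rwa [zero_mul] at this
    filter_upwards [h0.eventually_lt_const hη] with n hn t ht
    rw [dist_comm]
    refine (dist_le_pi_dist _ _ i).trans_lt (lt_of_le_of_lt ?_ hn)
    exact dist_iterate_stageMap_le hδ hβ (hyU t ht)
      ((hg.holomorphicAlong (hτε t ht)).mono (hyU t ht)) (hgβ _ (hτε t ht)) hsmall n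
  exact hunif.tendstoLocallyUniformlyOn.differentiableOn
    (Eventually.of_forall fun n => hdiff n i) hW

section Orbit

variable {Φ : RungeKutta s} {U : Set (CVec D)} {g : CVec D → CVec D} {y : CVec D} {δ β : ℝ} {S : ℕ}

theorem norm_step_sub_le (hβ : 0 ≤ β) (hgβ : ∀ u ∈ U, ‖g u‖ ≤ β)
    (hv : ∃ v, Φ.IsStages U g 1 y v) : ‖Φ.step U g 1 y - y‖ ≤ Φ.size * β := by
  rw [step_eq hv, add_sub_cancel_left]
  exact Φ.norm_sum_b_le hβ fun i => hgβ _ (isStages_stages hv i).1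

/-- The steps of the solver drift away from `y` by at most `size * β` each; so as long as they stay
well inside `U` the stages exist and are unique. -/
theorem solver_spec (hδ : 0 < δ) (hβ : 0 ≤ β) (hyU : ball y δ ⊆ U) (hg : HolomorphicAlong U g)
    (hgβ : ∀ u ∈ U, ‖g u‖ ≤ β) (hS : 1 ≤ S) (hsmall : 16 * (S * (Φ.size * β)) ≤ δ) {k : ℕ}
    (hk : k ≤ S) :
    ‖Φ.solver U g 1 k y - y‖ ≤ k * (Φ.size * β) ∧
      ball (Φ.solver U g 1 k y) (δ / 2) ⊆ U ∧
      ∃! v, Φ.IsStages U g 1 (Φ.solver U g 1 k y) v := by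
  have hS' : (1 : ℝ) ≤ S := by exact_mod_cast hS
  have hA : 0 ≤ Φ.size * β := mul_nonneg (by linarith [Φ.one_le_size]) hβ
  have hone : Φ.size * β ≤ S * (Φ.size * β) := by nlinarith
  have hrest : ∀ k : ℕ, k ≤ S → ‖Φ.solver U g 1 k y - y‖ ≤ k * (Φ.size * β) →
      ball (Φ.solver U g 1 k y) (δ / 2) ⊆ U ∧
        ∃! v, Φ.IsStages U g 1 (Φ.solver U g 1 k y) v := by
    intro k hk hn
    have hkS : (k : ℝ) * (Φ.size * β) ≤ S * (Φ.size * β) :=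
      mul_le_mul_of_nonneg_right (by exact_mod_cast hk) hA
    have hsub : ball (Φ.solver U g 1 k y) (δ / 2) ⊆ U := by
      refine (ball_subset_ball' ?_).trans hyU
      rw [dist_eq_norm]
      linarith
    exact ⟨hsub, existsUnique_stages (half_pos hδ) hβ hsub (hg.mono hsub) hgβ (by linarith)⟩
  have hn : ‖Φ.solver U g 1 k y - y‖ ≤ k * (Φ.size * β) := by
    induction k with
    | zero => simp [solver]
    | succ k ih =>
      have h1 := ih (by omega)
      have h2 := norm_step_sub_le hβ hgβ (hrest k (by omega) h1).2.exists
      rw [solver_succ]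
      calc ‖Φ.step U g 1 (Φ.solver U g 1 k y) - y‖
          ≤ ‖Φ.step U g 1 (Φ.solver U g 1 k y) - Φ.solver U g 1 k y‖ +
            ‖Φ.solver U g 1 k y - y‖ := norm_sub_le_norm_sub_add_norm_sub _ _ _
        _ ≤ Φ.size * β + k * (Φ.size * β) := add_le_add h2 h1
        _ = (k + 1 : ℕ) * (Φ.size * β) := by push_cast; ring
  exact ⟨hn, hrest k hk hn⟩

theorem norm_stages_sub_le (hδ : 0 < δ) (hβ : 0 ≤ β) (hyU : ball y δ ⊆ U)
    (hg : HolomorphicAlong U g) (hgβ : ∀ u ∈ U, ‖g u‖ ≤ β) (hS : 1 ≤ S)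
    (hsmall : 16 * (S * (Φ.size * β)) ≤ δ) {k : ℕ} (hk : k < S) (i : Fin s) :
    ‖Φ.stages U g (Φ.solver U g 1 k y) i - y‖ ≤ S * (Φ.size * β) := by
  obtain ⟨h1, -, h2⟩ := solver_spec hδ hβ hyU hg hgβ hS hsmall hk.le
  have h3 := (isStages_stages h2.exists).norm_sub_le hβ hgβ i
  have hA : 0 ≤ Φ.size * β := mul_nonneg (by linarith [Φ.one_le_size]) hβ
  calc _ ≤ ‖Φ.stages U g (Φ.solver U g 1 k y) i - Φ.solver U g 1 k y‖ +
        ‖Φ.solver U g 1 k y - y‖ := norm_sub_le_norm_sub_add_norm_sub _ _ _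
    _ ≤ Φ.size * β + k * (Φ.size * β) := add_le_add h3 h1
    _ = (k + 1 : ℕ) * (Φ.size * β) := by push_cast; ring
    _ ≤ S * (Φ.size * β) := mul_le_mul_of_nonneg_right (by exact_mod_cast hk) hA

end Orbit

/-- The increment of the numerical solution over `S` steps for the field `τ • G τ`, divided by
`τ`; written as a sum, it makes sense for `τ = 0` as well. -/
noncomputable def increment (Φ : RungeKutta s) (U : Set (CVec D)) (G : ℂ → CVec D → CVec D) (S : ℕ) (τ : ℂ)
    (y : CVec D) : CVec D :=
  ∑ k ∈ Finset.range S, ∑ i, Φ.b i •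
    G τ (Φ.stages U (fun u => τ • G τ u) (Φ.solver U (fun u => τ • G τ u) 1 k y) i)

section Family

variable {Φ : RungeKutta s} {U : Set (CVec D)} {G : ℂ → CVec D → CVec D} {δ β ε : ℝ} {S : ℕ}

theorem solver_eq_add_smul_increment {τ : ℂ} {y : CVec D} (hδ : 0 < δ) (hβ : 0 ≤ β)
    (hyU : ball y δ ⊆ U) (hG : HolomorphicAlong U (G τ)) (hGβ : ∀ u ∈ U, ‖τ • G τ u‖ ≤ β)
    (hS : 1 ≤ S) (hsmall : 16 * (S * (Φ.size * β)) ≤ δ) :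
    Φ.solver U (fun u => τ • G τ u) 1 S y = y + τ • Φ.increment U G S τ y := by
  suffices h : ∀ k ≤ S, Φ.solver U (fun u => τ • G τ u) 1 k y =
      y + τ • Φ.increment U G k τ y from h S le_rfl
  intro k
  induction k with
  | zero => simp [solver, increment]
  | succ k ih =>
    intro hk
    obtain ⟨-, -, h⟩ :=
      solver_spec hδ hβ hyU (hG.const_smul τ) hGβ hS hsmall (Nat.le_of_succ_le hk) (Φ := Φ)
    rw [solver_succ, step_eq h.exists, increment, Finset.sum_range_succ, smul_add, ← increment,
      ← add_assoc, ← ih (by omega), Finset.smul_sum]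
    simp only [smul_comm τ]

theorem differentiableOn_solver (hδ : 0 < δ) (hβ : 0 ≤ β) (hG : HolomorphicFamily ε U G)
    (hGβ : ∀ τ ∈ ball (0 : ℂ) ε, ∀ u ∈ U, ‖τ • G τ u‖ ≤ β) (hS : 1 ≤ S)
    (hsmall : 16 * (S * (Φ.size * β)) ≤ δ)
    {W : Set ℂ} {τ : ℂ → ℂ} {y : ℂ → CVec D} (hW : IsOpen W) (hτ : DifferentiableOn ℂ τ W)
    (hy : DifferentiableOn ℂ y W) (hτε : ∀ t ∈ W, τ t ∈ ball (0 : ℂ) ε)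
    (hyU : ∀ t ∈ W, ball (y t) δ ⊆ U) {k : ℕ} (hk : k < S) :
    DifferentiableOn ℂ (fun t => Φ.solver U (fun u => τ t • G (τ t) u) 1 k (y t)) W ∧
    ∀ i, DifferentiableOn ℂ (fun t => Φ.stages U (fun u => τ t • G (τ t) u)
      (Φ.solver U (fun u => τ t • G (τ t) u) 1 k (y t)) i) W := by
  have hS' : (1 : ℝ) ≤ S := by exact_mod_cast hS
  have hA : 0 ≤ Φ.size * β := mul_nonneg (by linarith [Φ.one_le_size]) hβ
  have hone : Φ.size * β ≤ S * (Φ.size * β) := by nlinarith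
  have hτG : HolomorphicFamily ε U (fun τ u => τ • G τ u) :=
    fun W τ u hW hτ hu hτε huV => hτ.smul (hG W τ u hW hτ hu hτε huV)
  have hspec : ∀ t ∈ W, ∀ k ≤ S, _ := fun t ht k hk =>
    solver_spec hδ hβ (hyU t ht) (hτG.holomorphicAlong (hτε t ht)) (hGβ _ (hτε t ht))
      hS hsmall hk (Φ := Φ)
  have hstage : ∀ k < S,
      DifferentiableOn ℂ (fun t => Φ.solver U (fun u => τ t • G (τ t) u) 1 k (y t)) W →
      ∀ i, DifferentiableOn ℂ (fun t => Φ.stages U (fun u => τ t • G (τ t) u)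
        (Φ.solver U (fun u => τ t • G (τ t) u) 1 k (y t)) i) W := fun k hk hd i =>
    differentiableOn_stages (half_pos hδ) hβ hτG hGβ (by linarith) hW hτ hd hτε
      (fun t ht => (hspec t ht k hk.le).2.1) i
  have hsolver : DifferentiableOn ℂ
      (fun t => Φ.solver U (fun u => τ t • G (τ t) u) 1 k (y t)) W := by
    induction k with
    | zero => exact hy
    | succ k ih =>
      have hd := ih (by omega)
      have : DifferentiableOn ℂ (fun t => Φ.solver U (fun u => τ t • G (τ t) u) 1 k (y t) +
          ∑ i, Φ.b i • (τ t • G (τ t) (Φ.stages U (fun u => τ t • G (τ t) u)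
            (Φ.solver U (fun u => τ t • G (τ t) u) 1 k (y t)) i))) W := by
        refine hd.add (DifferentiableOn.fun_sum fun i _ => DifferentiableOn.fun_const_smul ?_ _)
        exact hτG W τ _ hW hτ (hstage k (by omega) hd i) hτε fun t ht =>
          (isStages_stages (hspec t ht k (by omega)).2.2.exists i).1
      refine this.congr fun t ht => ?_
      rw [solver_succ, step_eq (hspec t ht k (by omega)).2.2.exists]
  exact ⟨hsolver, hstage k hk hsolver⟩

theorem holomorphicFamily_increment (hδ : 0 < δ) (hβ : 0 ≤ β) (hG : HolomorphicFamily ε U G)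
    (hGβ : ∀ τ ∈ ball (0 : ℂ) ε, ∀ u ∈ U, ‖τ • G τ u‖ ≤ β) (hS : 1 ≤ S)
    (hsmall : 16 * (S * (Φ.size * β)) ≤ δ) {V : Set (CVec D)} (hV : ∀ y ∈ V, ball y δ ⊆ U) :
    HolomorphicFamily ε V (Φ.increment U G S) := by
  intro W τ y hW hτ hy hτε hyV
  have hyU : ∀ t ∈ W, ball (y t) δ ⊆ U := fun t ht => hV _ (hyV t ht)
  refine DifferentiableOn.fun_sum fun k hk => DifferentiableOn.fun_sum fun i _ =>
    DifferentiableOn.fun_const_smul ?_ _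
  have hk' := Finset.mem_range.1 hk
  refine hG W τ _ hW hτ ((differentiableOn_solver hδ hβ hG hGβ hS hsmall hW hτ hy hτε hyU
    hk').2 i) hτε fun t ht => ?_
  exact (isStages_stages (solver_spec hδ hβ (hyU t ht)
    ((hG.holomorphicAlong (hτε t ht)).const_smul (τ t)) (hGβ _ (hτε t ht)) hS hsmall
    hk'.le).2.2.exists i).1

end Family

end RungeKutta

/-! ### The flow for complex times -/

section Flow

variable {D : ℕ} {U : Set (CVec D)} {f : CVec D → CVec D} {y : CVec D} {t δ β : ℝ}

theorem IsSolution.norm_sub_le {c : ℝ → CVec D} (hc : IsSolution U f t y c)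
    (hfβ : ∀ u ∈ U, ‖f u‖ ≤ β) {a b : ℝ} (ha : a ∈ Set.Icc 0 t) (hb : b ∈ Set.Icc 0 t) :
    ‖c b - c a‖ ≤ β * |b - a| := by
  rw [← Real.norm_eq_abs]
  exact Convex.norm_image_sub_le_of_norm_hasDerivWithin_le (fun τ hτ => (hc.2 τ hτ).2)
    (fun τ hτ => hfβ _ (hc.2 τ hτ).1) (convex_Icc 0 t) ha hb

theorem IsSolution.mem_closedBall {c : ℝ → CVec D} (hc : IsSolution U f t y c) (hβ : 0 ≤ β)
    (hfβ : ∀ u ∈ U, ‖f u‖ ≤ β) {a : ℝ} (ha : a ∈ Set.Icc 0 t) :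
    c a ∈ closedBall y (β * t) := by
  have h := hc.norm_sub_le hfβ ⟨le_rfl, ha.1.trans ha.2⟩ ha
  rw [hc.1, sub_zero, abs_of_nonneg ha.1] at h
  rw [mem_closedBall_iff_norm]
  exact h.trans (mul_le_mul_of_nonneg_left ha.2 hβ)

/-- The Picard–Lindelöf theorem, keeping track of the ball in which the solution stays. -/
theorem _root_.IsPicardLindelof.exists_mem_closedBall_hasDerivWithinAt
    {E : Type*} [NormedAddCommGroup E] [NormedSpace ℝ E] [CompleteSpace E] {f : ℝ → E → E}
    {tmin tmax : ℝ} {t₀ : Set.Icc tmin tmax} {x₀ x : E} {a r L K : NNReal}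
    (hf : IsPicardLindelof f t₀ x₀ a r L K) (hx : x ∈ closedBall x₀ r) :
    ∃ α : ℝ → E, α t₀ = x ∧ ∀ t ∈ Set.Icc tmin tmax, α t ∈ closedBall x₀ a ∧
      HasDerivWithinAt α (f t (α t)) (Set.Icc tmin tmax) t := by
  obtain ⟨α, hα⟩ := ODE.FunSpace.exists_isFixedPt_next hf hx
  refine ⟨α.compProj, ?_, fun t ht => ⟨α.compProj_mem_closedBall hf.mul_max_le, ?_⟩⟩
  · rw [ODE.FunSpace.compProj_val, ← hα, ODE.FunSpace.next_apply₀]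
  · apply ODE.hasDerivWithinAt_picard_Icc t₀.2 hf.continuousOn_uncurry
      α.continuous_compProj.continuousOn (fun _ _ => α.compProj_mem_closedBall hf.mul_max_le)
      x ht |>.congr_of_mem _ ht
    intro t' ht'
    nth_rw 1 [← hα]
    rw [ODE.FunSpace.compProj_of_mem ht', ODE.FunSpace.next_apply]

theorem flowDefinedAt_of_bound (hδ : 0 < δ) (hβ : 0 ≤ β) (ht : 0 ≤ t) (hyU : ball y δ ⊆ U)
    (hf : HolomorphicAlong (ball y δ) f) (hfβ : ∀ u ∈ U, ‖f u‖ ≤ β) (hsmall : 4 * (β * t) ≤ δ) :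
    FlowDefinedAt U f t y := by
  have hsub : closedBall y (δ / 4) ⊆ ball y (δ / 2) := closedBall_subset_ball (by linarith)
  have hsubU : closedBall y (δ / 4) ⊆ U :=
    (hsub.trans (ball_subset_ball (by linarith))).trans hyU
  have hlip : LipschitzOnWith (4 * β / δ).toNNReal f (closedBall y (δ / 4)) := by
    refine LipschitzOnWith.of_dist_le_mul fun u hu w hw => ?_
    rw [dist_eq_norm, dist_eq_norm, Real.coe_toNNReal _ (by positivity)]
    exact hf.norm_sub_le (fun u hu => hfβ u (hyU hu)) (hsub hu) (hsub hw)
  constructor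
  · have hPL : IsPicardLindelof (fun _ => f) (⟨0, Set.left_mem_Icc.2 ht⟩ : Set.Icc 0 t) y
        (δ / 4).toNNReal 0 β.toNNReal (4 * β / δ).toNNReal := by
      refine IsPicardLindelof.of_time_independent ?_ ?_ ?_
      · rw [Real.coe_toNNReal _ (by positivity), Real.coe_toNNReal _ hβ]
        exact fun u hu => hfβ u (hsubU hu)
      · rwa [Real.coe_toNNReal _ (by positivity)]
      · rw [Real.coe_toNNReal (δ / 4) (by positivity), Real.coe_toNNReal _ hβ]
        simp only [sub_zero, sub_self, NNReal.coe_zero, max_eq_left ht]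
        linarith
    obtain ⟨c, hc0, hc⟩ := hPL.exists_mem_closedBall_hasDerivWithinAt (x := y)
      (mem_closedBall_self le_rfl)
    rw [Real.coe_toNNReal _ (by positivity)] at hc
    exact ⟨c, hc0, fun τ hτ => ⟨hsubU (hc τ hτ).1, (hc τ hτ).2⟩⟩
  · intro c c' hc hc'
    refine ODE_solution_unique_of_mem_Icc_right (v := fun _ => f)
      (s := fun _ => closedBall y (δ / 4)) (fun _ _ => hlip)
      (fun τ hτ => (hc.2 τ hτ).2.continuousWithinAt) (fun τ hτ => ?_) (fun τ hτ => ?_)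
      (fun τ hτ => (hc'.2 τ hτ).2.continuousWithinAt) (fun τ hτ => ?_) (fun τ hτ => ?_)
      (hc.1.trans hc'.1.symm)
    · exact (hc.2 τ (Set.Ico_subset_Icc_self hτ)).2.mono_of_mem_nhdsWithin
        (Icc_mem_nhdsGE_of_mem hτ)
    · exact closedBall_subset_closedBall (by linarith)
        (hc.mem_closedBall hβ hfβ (Set.Ico_subset_Icc_self hτ))
    · exact (hc'.2 τ (Set.Ico_subset_Icc_self hτ)).2.mono_of_mem_nhdsWithin
        (Icc_mem_nhdsGE_of_mem hτ)
    · exact closedBall_subset_closedBall (by linarith)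
        (hc'.mem_closedBall hβ hfβ (Set.Ico_subset_Icc_self hτ))

theorem FlowDefinedAt.flow_eq {c : ℝ → CVec D} (h : FlowDefinedAt U f t y) (ht : 0 ≤ t)
    (hc : IsSolution U f t y c) : flow U f t y = c t := by
  rw [flow, dif_pos h.1]
  exact h.2 _ _ h.1.choose_spec hc ⟨ht, le_rfl⟩

/-- Rescaling time replaces the field `f` by a multiple of `f`. -/
theorem IsSolution.rescale {h a : ℝ} (hh : 0 < h) {c : ℝ → CVec D}
    (hc : IsSolution U f (a * h) y c) :
    IsSolution U (fun u => (h : ℂ) • f u) a y (fun r => c (r * h)) := by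
  refine ⟨by simpa using hc.1, fun r hr => ?_⟩
  have hmaps : Set.MapsTo (fun r : ℝ => r * h) (Set.Icc 0 a) (Set.Icc 0 (a * h)) := fun r hr =>
    ⟨mul_nonneg hr.1 hh.le, mul_le_mul_of_nonneg_right hr.2 hh.le⟩
  obtain ⟨h1, h2⟩ := hc.2 _ (hmaps hr)
  refine ⟨h1, ?_⟩
  have h3 : HasDerivWithinAt (fun r : ℝ => r * h) h (Set.Icc 0 a) r := by
    simpa using (hasDerivWithinAt_id r (Set.Icc 0 a)).mul_const h
  have h4 := h2.scomp r h3 hmaps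
  rw [← Complex.coe_smul] at h4
  exact h4

theorem flow_rescale {h a : ℝ} (hh : 0 < h) (ha : 0 ≤ a) (hdef : FlowDefinedAt U f (a * h) y)
    (hdef' : FlowDefinedAt U (fun u => (h : ℂ) • f u) a y) :
    flow U f (a * h) y = flow U (fun u => (h : ℂ) • f u) a y := by
  obtain ⟨c, hc⟩ := hdef.1
  rw [hdef.flow_eq (by positivity) hc, hdef'.flow_eq ha (hc.rescale hh)]

end Flow

/-! ### Holomorphic dependence of the flow, by Euler's method -/

section Euler

variable {D : ℕ} {U : Set (CVec D)} {y : CVec D} {δ β : ℝ} {S n : ℕ}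

/-- The `k`-th point of Euler's method with step size `θ`. -/
noncomputable def eulerPoint (g : CVec D → CVec D) (θ : ℝ) (y : CVec D) : ℕ → CVec D
  | 0 => y
  | k + 1 => eulerPoint g θ y k + θ • g (eulerPoint g θ y k)

theorem norm_eulerPoint_sub_le {g : CVec D → CVec D} (hβ : 0 ≤ β) (hyU : ball y δ ⊆ U)
    (hgβ : ∀ u ∈ U, ‖g u‖ ≤ β) {θ : ℝ} (hθ : 0 ≤ θ) {n : ℕ} (hsmall : n * θ * β < δ) {k : ℕ}
    (hk : k ≤ n) : ‖eulerPoint g θ y k - y‖ ≤ k * θ * β := by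
  induction k with
  | zero => simp [eulerPoint]
  | succ k ih =>
    have h1 := ih (by omega)
    have hk' : (k : ℝ) ≤ n := by exact_mod_cast Nat.le_of_succ_le hk
    have h2 : eulerPoint g θ y k ∈ U := by
      refine hyU (mem_ball_iff_norm.2 (h1.trans_lt (lt_of_le_of_lt ?_ hsmall)))
      gcongr
    calc ‖eulerPoint g θ y (k + 1) - y‖
        = ‖(eulerPoint g θ y k - y) + θ • g (eulerPoint g θ y k)‖ := by
          rw [eulerPoint]; congr 1; abel
      _ ≤ k * θ * β + θ * β := by
        refine norm_add_le_of_le h1 ?_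
        rw [norm_smul, Real.norm_of_nonneg hθ]
        exact mul_le_mul_of_nonneg_left (hgβ _ h2) hθ
      _ = (k + 1 : ℕ) * θ * β := by push_cast; ring

/-- Convergence of Euler's method for a bounded holomorphic field. -/
theorem norm_eulerPoint_sub_solution_le {g : CVec D → CVec D} (hδ : 0 < δ) (hβ : 0 ≤ β)
    (hyU : ball y δ ⊆ U) (hg : HolomorphicAlong (ball y δ) g) (hgβ : ∀ u ∈ U, ‖g u‖ ≤ β)
    (hsmall : 8 * (S * β) ≤ δ) (hn : 0 < n) {c : ℝ → CVec D} (hc : IsSolution U g S y c) :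
    ‖eulerPoint g (S / n) y n - c S‖ ≤ 8 * (S * β) ^ 2 / (δ * n) := by
  set θ : ℝ := S / n with hθ
  have hn' : (0 : ℝ) < n := by exact_mod_cast hn
  have hθ0 : 0 ≤ θ := by positivity
  have hnθ : n * θ = S := by rw [hθ]; field_simp
  set l := 4 * β / δ with hl
  have hl0 : 0 ≤ l := by positivity
  have hlS : 2 * (S * l) ≤ 1 := by
    rw [hl, mul_div_assoc', mul_div_assoc', div_le_iff₀ hδ]
    linarith
  have hlip : ∀ u ∈ ball y (δ / 2), ∀ w ∈ ball y (δ / 2), ‖g u - g w‖ ≤ l * ‖u - w‖ :=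
    fun u hu w hw => hg.norm_sub_le (fun u hu => hgβ u (hyU hu)) hu hw
  have hcball : ∀ r ∈ Set.Icc (0 : ℝ) S, c r ∈ ball y (δ / 2) := fun r hr =>
    closedBall_subset_ball (by linarith) (hc.mem_closedBall hβ hgβ hr)
  have heball : ∀ k ≤ n, eulerPoint g θ y k ∈ ball y (δ / 2) := by
    intro k hk
    have hk' : (k : ℝ) ≤ n := by exact_mod_cast hk
    have h1 : (k : ℝ) * θ * β ≤ n * θ * β := by gcongr
    have h2 := norm_eulerPoint_sub_le hβ hyU hgβ hθ0
      (show n * θ * β < δ by rw [hnθ]; linarith) hk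
    rw [hnθ] at h1
    rw [mem_ball_iff_norm]
    linarith
  have hmem : ∀ k ≤ n, (k : ℝ) * θ ∈ Set.Icc (0 : ℝ) S := by
    intro k hk
    have hk' : (k : ℝ) ≤ n := by exact_mod_cast hk
    exact ⟨by positivity, by rw [← hnθ]; gcongr⟩
  -- the local error
  have hlocal : ∀ k < n, ‖c ((k + 1 : ℕ) * θ) - c (k * θ) - θ • g (c (k * θ))‖ ≤
      l * (β * θ) * θ := by
    intro k hk
    have hk0 := hmem k hk.le
    have hk1 := hmem (k + 1) hk
    have hstep : ((k + 1 : ℕ) : ℝ) * θ = k * θ + θ := by push_cast; ring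
    have hsub : Set.Icc ((k : ℝ) * θ) ((k + 1 : ℕ) * θ) ⊆ Set.Icc (0 : ℝ) S :=
      Set.Icc_subset_Icc hk0.1 hk1.2
    have hd : ∀ r ∈ Set.Icc ((k : ℝ) * θ) ((k + 1 : ℕ) * θ),
        HasDerivWithinAt (fun r : ℝ => c r - (r - k * θ) • g (c (k * θ)))
          (g (c r) - g (c (k * θ))) (Set.Icc ((k : ℝ) * θ) ((k + 1 : ℕ) * θ)) r := by
      intro r hr
      have h1 : HasDerivWithinAt (fun r : ℝ => (r - k * θ) • g (c (k * θ)))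
          ((1 : ℝ) • g (c (k * θ))) (Set.Icc ((k : ℝ) * θ) ((k + 1 : ℕ) * θ)) r :=
        ((hasDerivWithinAt_id r _).sub_const _).smul_const _
      rw [one_smul] at h1
      exact ((hc.2 r (hsub hr)).2.mono hsub).sub h1
    have hb : ∀ r ∈ Set.Icc ((k : ℝ) * θ) ((k + 1 : ℕ) * θ),
        ‖g (c r) - g (c (k * θ))‖ ≤ l * (β * θ) := by
      intro r hr
      refine (hlip _ (hcball r (hsub hr)) _ (hcball _ hk0)).trans ?_
      gcongr
      refine (hc.norm_sub_le hgβ hk0 (hsub hr)).trans ?_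
      gcongr
      rw [abs_of_nonneg (sub_nonneg.2 hr.1)]
      linarith [hr.2]
    have hle : (k : ℝ) * θ ≤ (k + 1 : ℕ) * θ := by rw [hstep]; linarith
    have := Convex.norm_image_sub_le_of_norm_hasDerivWithin_le hd hb (convex_Icc _ _)
      (Set.left_mem_Icc.2 hle) (Set.right_mem_Icc.2 hle)
    rw [Real.norm_of_nonneg (sub_nonneg.2 hle), sub_self, zero_smul, sub_zero, hstep,
      add_sub_cancel_left] at this
    rw [hstep, sub_right_comm]
    exact this
  have hacc : ∀ k ≤ n, ‖eulerPoint g θ y k - c (k * θ)‖ ≤ 2 * k * (l * (β * θ) * θ) := by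
    intro k
    induction k with
    | zero => intro _; simp [eulerPoint, hc.1]
    | succ k ih =>
      intro hk
      have h1 := ih (by omega)
      have h2 := hlocal k (by omega)
      have hk' : (k : ℝ) ≤ n := by exact_mod_cast Nat.le_of_succ_le hk
      have h3 := hlip _ (heball k (by omega)) _ (hcball _ (hmem k (by omega)))
      have hkl : 2 * (k * (θ * l)) ≤ 1 := by
        refine le_trans ?_ hlS
        rw [← hnθ, mul_assoc (n : ℝ)]
        gcongr
      have h4 : ‖θ • (g (eulerPoint g θ y k) - g (c (k * θ)))‖ ≤ l * (β * θ) * θ := by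
        rw [norm_smul, Real.norm_of_nonneg hθ0]
        calc θ * ‖g (eulerPoint g θ y k) - g (c (k * θ))‖
            ≤ θ * (l * (2 * k * (l * (β * θ) * θ))) :=
              mul_le_mul_of_nonneg_left (h3.trans (mul_le_mul_of_nonneg_left h1 hl0)) hθ0
          _ = 2 * (k * (θ * l)) * (l * (β * θ) * θ) := by ring
          _ ≤ 1 * (l * (β * θ) * θ) := by gcongr
          _ = l * (β * θ) * θ := one_mul _
      calc ‖eulerPoint g θ y (k + 1) - c ((k + 1 : ℕ) * θ)‖
          = ‖(eulerPoint g θ y k - c (k * θ)) +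
              θ • (g (eulerPoint g θ y k) - g (c (k * θ))) -
              (c ((k + 1 : ℕ) * θ) - c (k * θ) - θ • g (c (k * θ)))‖ := by
            rw [eulerPoint, smul_sub]; congr 1; abel
        _ ≤ 2 * k * (l * (β * θ) * θ) + l * (β * θ) * θ + l * (β * θ) * θ :=
            norm_sub_le_of_le (norm_add_le_of_le h1 h4) h2
        _ = 2 * (k + 1 : ℕ) * (l * (β * θ) * θ) := by push_cast; ring
  have := hacc n le_rfl
  rw [hnθ] at this
  refine this.trans_eq ?_
  rw [hl, hθ]
  field_simp
  ring

end Euler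

section FlowIncrement

variable {D : ℕ} {U : Set (CVec D)} {f : CVec D → CVec D} {δ ε m : ℝ} {S : ℕ}

/-- The increment `(φ_{Sτ,f}(y) - y) / τ` of the flow, with its limit `S f(y)` as value at
`τ = 0`. The flow for the complex time `S τ` is the flow of the field `τ f` for the time `S`. -/
noncomputable def flowIncrement (U : Set (CVec D)) (f : CVec D → CVec D) (S : ℕ) (τ : ℂ) (y : CVec D) : CVec D :=
  if τ = 0 then (S : ℂ) • f y else τ⁻¹ • (flow U (fun u => τ • f u) S y - y)

/-- The corresponding increment of Euler's method with `n` substeps; being a sum, it makes sense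
for `τ = 0` as well. -/
noncomputable def eulerIncrement (f : CVec D → CVec D) (S n : ℕ) (τ : ℂ) (y : CVec D) : CVec D :=
  ∑ k ∈ Finset.range n, (S / n : ℝ) • f (eulerPoint (fun u => τ • f u) (S / n) y k)

theorem norm_smul_field_le (hfm : ∀ u ∈ U, ‖f u‖ ≤ m) (τ : ℂ) :
    ∀ u ∈ U, ‖τ • f u‖ ≤ ‖τ‖ * m := fun u hu => by
  rw [norm_smul]
  exact mul_le_mul_of_nonneg_left (hfm u hu) (norm_nonneg _)

theorem eulerPoint_eq (f : CVec D → CVec D) (θ : ℝ) (τ : ℂ) (y : CVec D) (n : ℕ) :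
    eulerPoint (fun u => τ • f u) θ y n = y + τ • ∑ k ∈ Finset.range n,
      θ • f (eulerPoint (fun u => τ • f u) θ y k) := by
  induction n with
  | zero => simp [eulerPoint]
  | succ n ih =>
    rw [Finset.sum_range_succ, smul_add, ← add_assoc, ← ih, eulerPoint, smul_comm τ]

theorem flow_eq_add_smul_flowIncrement {τ : ℂ} (hτ : τ ≠ 0) (y : CVec D) :
    flow U (fun u => τ • f u) S y = y + τ • flowIncrement U f S τ y := by
  rw [flowIncrement, if_neg hτ, smul_inv_smul₀ hτ, add_sub_cancel]

theorem flowDefinedAt_smul {y : CVec D} (hδ : 0 < δ) (hm : 0 ≤ m) (hyU : ball y δ ⊆ U)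
    (hf : HolomorphicAlong U f) (hfm : ∀ u ∈ U, ‖f u‖ ≤ m) {τ : ℂ}
    (hsmall : 8 * (S * (‖τ‖ * m)) ≤ δ) : FlowDefinedAt U (fun u => τ • f u) S y := by
  have : 0 ≤ S * (‖τ‖ * m) := by positivity
  refine flowDefinedAt_of_bound hδ (by positivity) (by positivity) hyU
    ((hf.mono hyU).const_smul τ) (norm_smul_field_le hfm τ) ?_
  rw [mul_comm (‖τ‖ * m)]
  linarith

theorem norm_eulerIncrement_sub_le {y : CVec D} (hδ : 0 < δ) (hm : 0 ≤ m) (hyU : ball y δ ⊆ U)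
    (hf : HolomorphicAlong U f) (hfm : ∀ u ∈ U, ‖f u‖ ≤ m) {τ : ℂ}
    (hsmall : 8 * (S * (‖τ‖ * m)) ≤ δ) {n : ℕ} (hn : 0 < n) :
    ‖eulerIncrement f S n τ y - flowIncrement U f S τ y‖ ≤
      8 * (S * m) ^ 2 * ‖τ‖ / (δ * n) := by
  have hn' : (0 : ℝ) < n := by exact_mod_cast hn
  rcases eq_or_ne τ 0 with rfl | hτ
  · have hpt : ∀ k, eulerPoint (fun u => (0 : ℂ) • f u) (S / n) y k = y := fun k => by
      rw [eulerPoint_eq, zero_smul, add_zero]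
    have : eulerIncrement f S n 0 y = flowIncrement U f S 0 y := by
      simp only [eulerIncrement, hpt, Finset.sum_const, Finset.card_range, flowIncrement, if_true]
      rw [← Nat.cast_smul_eq_nsmul ℝ, smul_smul, mul_div_cancel₀ _ hn'.ne',
        ← Complex.coe_smul, Complex.ofReal_natCast]
    rw [this, sub_self, norm_zero]
    positivity
  · have hdef := flowDefinedAt_smul hδ hm hyU hf hfm hsmall
    obtain ⟨c, hc⟩ := hdef.1
    have h1 := norm_eulerPoint_sub_solution_le hδ (by positivity) hyU
      ((hf.mono hyU).const_smul τ) (norm_smul_field_le hfm τ) hsmall hn hc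
    rw [← hdef.flow_eq (by positivity) hc, flow_eq_add_smul_flowIncrement hτ, eulerPoint_eq,
      add_sub_add_left_eq_sub, ← smul_sub, norm_smul] at h1
    have hτ' : 0 < ‖τ‖ := norm_pos_iff.2 hτ
    refine le_of_mul_le_mul_left (h1.trans_eq ?_) hτ'
    ring

theorem norm_flowIncrement_le {y : CVec D} (hδ : 0 < δ) (hm : 0 ≤ m) (hyU : ball y δ ⊆ U)
    (hf : HolomorphicAlong U f) (hfm : ∀ u ∈ U, ‖f u‖ ≤ m) {τ : ℂ}
    (hsmall : 8 * (S * (‖τ‖ * m)) ≤ δ) : ‖flowIncrement U f S τ y‖ ≤ S * m := by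
  rcases eq_or_ne τ 0 with rfl | hτ
  · rw [flowIncrement, if_pos rfl, norm_smul, Complex.norm_natCast]
    exact mul_le_mul_of_nonneg_left (hfm y (hyU (mem_ball_self hδ))) (by positivity)
  · have hdef := flowDefinedAt_smul hδ hm hyU hf hfm hsmall
    obtain ⟨c, hc⟩ := hdef.1
    have h1 := hc.mem_closedBall (by positivity) (norm_smul_field_le hfm τ)
      (Set.right_mem_Icc.2 (Nat.cast_nonneg S))
    rw [← hdef.flow_eq (by positivity) hc, mem_closedBall_iff_norm,
      flow_eq_add_smul_flowIncrement hτ, add_sub_cancel_left, norm_smul] at h1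
    have hτ' : 0 < ‖τ‖ := norm_pos_iff.2 hτ
    refine le_of_mul_le_mul_left (h1.trans_eq ?_) hτ'
    ring

/-- The flow increment is holomorphic in `(τ, y)`, as a uniform limit of Euler increments. -/
theorem holomorphicFamily_flowIncrement (hδ : 0 < δ) (hm : 0 ≤ m) (hf : HolomorphicAlong U f)
    (hfm : ∀ u ∈ U, ‖f u‖ ≤ m) (hsmall : 8 * (S * (ε * m)) ≤ δ) {V : Set (CVec D)}
    (hV : ∀ y ∈ V, ball y δ ⊆ U) : HolomorphicFamily ε V (flowIncrement U f S) := by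
  intro W τ y hW hτ hy hτε hyV
  have hτlt : ∀ t ∈ W, ‖τ t‖ < ε := fun t ht => by simpa using hτε t ht
  have hsm : ∀ t ∈ W, 8 * (S * (‖τ t‖ * m)) ≤ δ := fun t ht =>
    le_trans (by gcongr; exact (hτlt t ht).le) hsmall
  have hmem : ∀ n : ℕ, 0 < n → ∀ t ∈ W, ∀ k ≤ n,
      eulerPoint (fun u => τ t • f u) (S / n) (y t) k ∈ U := by
    intro n hn t ht k hk
    have hn' : (0 : ℝ) < n := by exact_mod_cast hn
    have hk' : (k : ℝ) ≤ n := by exact_mod_cast hk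
    have h0 : 0 ≤ S * (‖τ t‖ * m) := by positivity
    have hnS : (n : ℝ) * (S / n) * (‖τ t‖ * m) = S * (‖τ t‖ * m) := by field_simp
    have hlt : (n : ℝ) * (S / n) * (‖τ t‖ * m) < δ := by
      rw [hnS]
      linarith [hsm t ht]
    have := norm_eulerPoint_sub_le (by positivity) (hV _ (hyV t ht))
      (norm_smul_field_le hfm (τ t)) (by positivity) hlt hk
    refine hV _ (hyV t ht) (mem_ball_iff_norm.2 (this.trans_lt (lt_of_le_of_lt ?_ hlt)))
    gcongr
  have hpoint : ∀ n : ℕ, 0 < n → ∀ k ≤ n, DifferentiableOn ℂ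
      (fun t => eulerPoint (fun u => τ t • f u) (S / n) (y t) k) W := by
    intro n hn k
    induction k with
    | zero => exact fun _ => hy
    | succ k ih =>
      intro hk
      have h1 := ih (by omega)
      have h2 := hf W _ hW h1 fun t ht => hmem n hn t ht k (by omega)
      exact h1.add ((hτ.smul h2).fun_const_smul (S / n : ℝ))
  have hsum : ∀ n : ℕ, 0 < n → DifferentiableOn ℂ (fun t => eulerIncrement f S n (τ t) (y t)) W :=
    fun n hn => DifferentiableOn.fun_sum fun k hk => DifferentiableOn.fun_const_smul
      (hf W _ hW (hpoint n hn k (Finset.mem_range.1 hk).le)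
        fun t ht => hmem n hn t ht k (Finset.mem_range.1 hk).le) _
  have hunif : TendstoUniformlyOn (fun n t => eulerIncrement f S n (τ t) (y t))
      (fun t => flowIncrement U f S (τ t) (y t)) atTop W := by
    rw [Metric.tendstoUniformlyOn_iff]
    intro η hη
    have h0 : Tendsto (fun n : ℕ => 8 * (S * m) ^ 2 * ε / δ / n) atTop (𝓝 0) :=
      tendsto_const_div_atTop_nhds_zero_nat _
    filter_upwards [h0.eventually_lt_const hη, eventually_gt_atTop 0] with n hn hn0 t ht
    have hn' : (0 : ℝ) < n := by exact_mod_cast hn0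
    rw [dist_comm, dist_eq_norm]
    refine (norm_eulerIncrement_sub_le hδ hm (hV _ (hyV t ht)) hf hfm (hsm t ht) hn0).trans_lt
      (lt_of_le_of_lt ?_ hn)
    rw [div_div]
    gcongr
    exact (hτlt t ht).le
  exact hunif.tendstoLocallyUniformlyOn.differentiableOn
    ((eventually_gt_atTop 0).mono fun n hn => hsum n hn) hW

end FlowIncrement

/-! ### Taylor expansion of the flow -/

section FlowTaylor

variable {D : ℕ}

/-- Taylor's formula for a sequence of curves each of which is, up to the factor `z`, the
derivative of the preceding one. -/
theorem norm_sub_taylor_le_of_hasDerivWithinAt {e : ℕ → ℝ → CVec D} {z : ℂ} {C : ℝ}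
    (he : ∀ j, ∀ θ ∈ Set.Icc (0 : ℝ) 1,
      HasDerivWithinAt (e j) (z • e (j + 1) θ) (Set.Icc 0 1) θ) (M j : ℕ)
    (hC : ∀ θ ∈ Set.Icc (0 : ℝ) 1, ‖e (j + M) θ‖ ≤ C) :
    ∀ θ ∈ Set.Icc (0 : ℝ) 1,
      ‖e j θ - ∑ n ∈ Finset.range M, (θ ^ n / n.factorial : ℝ) • z ^ n • e (j + n) 0‖ ≤
        C * ‖z‖ ^ M := by
  induction M generalizing j with
  | zero => simpa using hC
  | succ M ih =>
    intro θ hθ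
    have hC' : ∀ θ ∈ Set.Icc (0 : ℝ) 1, ‖e (j + 1 + M) θ‖ ≤ C := by
      simpa only [add_assoc, add_comm 1 M] using hC
    have hC0 : 0 ≤ C := (norm_nonneg _).trans (hC θ hθ)
    have hd : ∀ r ∈ Set.Icc (0 : ℝ) 1, HasDerivWithinAt
        (fun r => e j r - ∑ n ∈ Finset.range (M + 1),
          (r ^ n / n.factorial : ℝ) • z ^ n • e (j + n) 0)
        (z • (e (j + 1) r - ∑ n ∈ Finset.range M,
          (r ^ n / n.factorial : ℝ) • z ^ n • e (j + 1 + n) 0)) (Set.Icc 0 1) r := by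
      intro r hr
      rw [smul_sub]
      refine (he j r hr).sub ?_
      simp_rw [Finset.sum_range_succ' _ M, pow_zero]
      have hsum : HasDerivWithinAt (fun r : ℝ => ∑ n ∈ Finset.range M,
            (r ^ (n + 1) / (n + 1).factorial : ℝ) • z ^ (n + 1) • e (j + (n + 1)) 0)
          (z • ∑ n ∈ Finset.range M, (r ^ n / n.factorial : ℝ) • z ^ n • e (j + 1 + n) 0)
          (Set.Icc 0 1) r := by
        rw [Finset.smul_sum]
        refine HasDerivWithinAt.fun_sum fun n _ => ?_
        have h1 : HasDerivAt (fun r : ℝ => r ^ (n + 1) / ((n + 1).factorial : ℝ))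
            (r ^ n / n.factorial) r := by
          have h2 := (hasDerivAt_pow (n + 1) r).div_const ((n + 1).factorial : ℝ)
          refine h2.congr_deriv ?_
          have h3 : (n.factorial : ℝ) ≠ 0 := by exact_mod_cast n.factorial_ne_zero
          rw [Nat.factorial_succ, Nat.add_sub_cancel]
          push_cast
          field_simp
        have h4 := (h1.smul_const (z ^ (n + 1) • e (j + (n + 1)) 0)).hasDerivWithinAt
          (s := Set.Icc (0 : ℝ) 1)
        refine h4.congr_deriv ?_
        rw [smul_comm z, smul_smul z, ← pow_succ', add_assoc, add_comm 1 n]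
      exact hsum.add_const _
    have hb : ∀ r ∈ Set.Icc (0 : ℝ) 1, ‖z • (e (j + 1) r - ∑ n ∈ Finset.range M,
          (r ^ n / n.factorial : ℝ) • z ^ n • e (j + 1 + n) 0)‖ ≤ C * ‖z‖ ^ (M + 1) := by
      intro r hr
      rw [norm_smul, pow_succ]
      nlinarith [ih (j + 1) hC' r hr, norm_nonneg z]
    have := Convex.norm_image_sub_le_of_norm_hasDerivWithin_le hd hb (convex_Icc 0 1)
      (Set.left_mem_Icc.2 zero_le_one) hθ
    have h0 : e j 0 - ∑ n ∈ Finset.range (M + 1),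
        ((0 : ℝ) ^ n / n.factorial : ℝ) • z ^ n • e (j + n) 0 = 0 := by
      rw [Finset.sum_range_succ']
      simp
    rw [h0, sub_zero, sub_zero, Real.norm_of_nonneg hθ.1] at this
    refine this.trans (mul_le_of_le_one_right (by positivity) hθ.2)

theorem analyticOnNhd_iterate_lieDeriv {U : Set (CVec D)} {f : CVec D → CVec D}
    (hf : AnalyticOnNhd ℂ f U) (n : ℕ) : AnalyticOnNhd ℂ ((lieDeriv f)^[n] id) U := by
  induction n with
  | zero => exact analyticOnNhd_id
  | succ n ih =>
    rw [Function.iterate_succ_apply']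
    exact fun y hy => AnalyticAt.comp₂
      (ContinuousLinearMap.analyticAt_bilinear (ContinuousLinearMap.id ℂ (CVec D →L[ℂ] CVec D)) _)
      (ih y hy).fderiv (hf y hy)

theorem analyticOnNhd_exactCoeff {U : Set (CVec D)} {f : CVec D → CVec D}
    (hf : AnalyticOnNhd ℂ f U) (n : ℕ) : AnalyticOnNhd ℂ (exactCoeff f n) U :=
  fun y hy => (analyticAt_const (v := (n.factorial : ℂ)⁻¹)).fun_smul
    (analyticOnNhd_iterate_lieDeriv hf n y hy)

/-- Taylor's formula for the flow over one unit of time. -/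
theorem IsSolution.norm_sub_exact_le {U V : Set (CVec D)} {f : CVec D → CVec D} {z : ℂ} {S : ℕ}
    {y : CVec D} {c : ℝ → CVec D} (hf : AnalyticOnNhd ℂ f U)
    (hc : IsSolution U (fun u => z • f u) S y c) (hcV : ∀ r ∈ Set.Icc (0 : ℝ) S, c r ∈ V)
    {M : ℕ} {C : ℝ} (hC : ∀ u ∈ V, ‖((lieDeriv f)^[M] id) u‖ ≤ C) {k : ℕ} (hk : k < S) :
    ‖c (k + 1) - ∑ n ∈ Finset.range M, z ^ n • exactCoeff f n (c k)‖ ≤ C * ‖z‖ ^ M := by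
  have hkS : (k : ℝ) + 1 ≤ S := by exact_mod_cast hk
  have hmaps : Set.MapsTo (fun θ : ℝ => k + θ) (Set.Icc 0 1) (Set.Icc (0 : ℝ) S) := fun θ hθ =>
    ⟨add_nonneg (Nat.cast_nonneg k) hθ.1, by linarith [hθ.2]⟩
  have he : ∀ j, ∀ θ ∈ Set.Icc (0 : ℝ) 1,
      HasDerivWithinAt (fun θ : ℝ => ((lieDeriv f)^[j] id) (c (k + θ)))
        (z • ((lieDeriv f)^[j + 1] id) (c (k + θ))) (Set.Icc 0 1) θ := by
    intro j θ hθ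
    obtain ⟨h1, h2⟩ := hc.2 _ (hmaps hθ)
    have h3 : HasDerivWithinAt (fun θ : ℝ => c (k + θ)) (z • f (c (k + θ))) (Set.Icc 0 1) θ := by
      have h4 : HasDerivWithinAt (fun θ : ℝ => (k : ℝ) + θ) 1 (Set.Icc 0 1) θ :=
        (hasDerivWithinAt_id θ _).const_add _
      have h5 := h2.scomp θ h4 hmaps
      rw [one_smul] at h5
      exact h5
    have h5 := ((analyticOnNhd_iterate_lieDeriv hf j) _ h1).differentiableAt.hasFDerivAt
    have h6 := (h5.restrictScalars ℝ).comp_hasDerivWithinAt θ h3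
    rw [Function.iterate_succ_apply']
    rw [ContinuousLinearMap.coe_restrictScalars', map_smul] at h6
    exact h6
  have := norm_sub_taylor_le_of_hasDerivWithinAt he M 0
    (fun θ hθ => by simpa using hC _ (hcV _ (hmaps hθ))) 1 (Set.right_mem_Icc.2 zero_le_one)
  refine (congrArg norm (congrArg₂ _ rfl (Finset.sum_congr rfl fun n _ => ?_))).trans_le this
  rw [exactCoeff, zero_add, add_zero, smul_comm, ← Complex.coe_smul]
  simp

end FlowTaylor

/-! ### The formal expansion of the inverse modified equation -/

namespace RungeKutta

variable {s D : ℕ}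

/-- The truncated formal field `∑ k < N, τ ^ k F k` at the `i`-th formal stage of order `n`, as a
function of the pair `(τ, y)`. -/
noncomputable def formalField (Φ : RungeKutta s) (F : ℕ → CVec D → CVec D) (N n : ℕ) (i : Fin s)
    (p : ℂ × CVec D) : CVec D :=
  ∑ k ∈ Finset.range N, p.1 ^ k • F k (Φ.formalStage F p.2 n p.1 i)

theorem formalStage_succ (Φ : RungeKutta s) (F : ℕ → CVec D → CVec D) (y : CVec D) (n : ℕ) (τ : ℂ)
    (i : Fin s) : Φ.formalStage F y (n + 1) τ i = Φ.formalStage F y n τ i +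
      τ ^ (n + 1) • ∑ j, Φ.a i j • taylorCoeff n (fun τ => Φ.formalField F (n + 1) n j (τ, y)) :=
  rfl

theorem numCoeffSucc_eq (Φ : RungeKutta s) (F : ℕ → CVec D → CVec D) (n : ℕ) (y : CVec D) :
    Φ.numCoeffSucc F n y =
      ∑ i, Φ.b i • taylorCoeff n (fun τ => Φ.formalField F (n + 1) n i (τ, y)) :=
  rfl

theorem formalStage_at_zero (Φ : RungeKutta s) (F : ℕ → CVec D → CVec D) (y : CVec D) (n : ℕ)
    (i : Fin s) : Φ.formalStage F y n 0 i = y := by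
  induction n with
  | zero => rfl
  | succ n ih => rw [formalStage_succ, ih, zero_pow n.succ_ne_zero, zero_smul, add_zero]

/-- The formal stages of order `n` involve only the first `n` coefficients of the field. -/
theorem formalStage_congr (Φ : RungeKutta s) {F F' : ℕ → CVec D → CVec D} {n : ℕ}
    (h : ∀ k < n, F k = F' k) (y : CVec D) : Φ.formalStage F y n = Φ.formalStage F' y n := by
  induction n with
  | zero => rfl
  | succ n ih =>
    have ih' := ih fun k hk => h k (hk.trans n.lt_succ_self)
    funext τ i
    have hfield : ∀ j τ, Φ.formalField F (n + 1) n j (τ, y) =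
        Φ.formalField F' (n + 1) n j (τ, y) := fun j τ => by
      refine Finset.sum_congr rfl fun k hk => ?_
      rw [h k (Finset.mem_range.1 hk), ih']
    simp only [formalStage_succ, ih', hfield]

section Analytic

variable {Φ : RungeKutta s} {F : ℕ → CVec D → CVec D} {x : CVec D}

theorem analyticAt_formalStage_and_formalField (hF : ∀ k, AnalyticAt ℂ (F k) x) (n : ℕ) :
    (∀ i, AnalyticAt ℂ (fun p : ℂ × CVec D => Φ.formalStage F p.2 n p.1 i) (0, x)) ∧
      ∀ N i, AnalyticAt ℂ (Φ.formalField F N n i) (0, x) := by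
  have hfield : ∀ n, (∀ i, AnalyticAt ℂ
      (fun p : ℂ × CVec D => Φ.formalStage F p.2 n p.1 i) (0, x)) →
      ∀ N i, AnalyticAt ℂ (Φ.formalField F N n i) (0, x) := by
    intro n hn N i
    refine Finset.analyticAt_fun_sum _ fun k _ => ?_
    exact (analyticAt_fst.pow k).smul
      ((hF k).fun_comp_of_eq (hn i) (Φ.formalStage_at_zero F x n i))
  suffices h : ∀ i, AnalyticAt ℂ (fun p : ℂ × CVec D => Φ.formalStage F p.2 n p.1 i) (0, x) from
    ⟨h, hfield n h⟩
  induction n with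
  | zero => exact fun i => analyticAt_snd
  | succ n ih =>
    intro i
    simp only [formalStage_succ]
    refine (ih i).fun_add ((analyticAt_fst.pow (n + 1)).fun_smul
      (Finset.analyticAt_fun_sum _ fun j _ => ?_))
    have h1 := analyticAt_taylorCoeff (hfield n ih (n + 1) j) n
    have h2 : AnalyticAt ℂ (fun p : ℂ × CVec D =>
        taylorCoeff n fun τ => Φ.formalField F (n + 1) n j (τ, p.2)) (0, x) :=
      AnalyticAt.fun_comp_of_eq (f := fun p : ℂ × CVec D => p.2) h1 analyticAt_snd rfl
    exact h2.fun_const_smul (c := Φ.a i j)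

theorem analyticAt_formalField (hF : ∀ k, AnalyticAt ℂ (F k) x) (N n : ℕ) (i : Fin s) :
    AnalyticAt ℂ (Φ.formalField F N n i) (0, x) :=
  (analyticAt_formalStage_and_formalField hF n).2 N i

theorem analyticAt_formalStage (hF : ∀ k, AnalyticAt ℂ (F k) x) (n : ℕ) (i : Fin s) :
    AnalyticAt ℂ (fun p : ℂ × CVec D => Φ.formalStage F p.2 n p.1 i) (0, x) :=
  (analyticAt_formalStage_and_formalField hF n).1 i

theorem tendsto_formalStage (hF : ∀ k, AnalyticAt ℂ (F k) x) (n : ℕ) (i : Fin s) :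
    Tendsto (fun p : ℂ × CVec D => Φ.formalStage F p.2 n p.1 i) (𝓝 (0, x)) (𝓝 x) := by
  have := (analyticAt_formalStage hF n i (Φ := Φ)).continuousAt.tendsto
  rwa [formalStage_at_zero] at this

theorem tendsto_prodMk_nhds_zero : Tendsto (fun τ : ℂ => (τ, x)) (𝓝 0) (𝓝 (0, x)) :=
  (Continuous.prodMk_left x).tendsto 0

theorem analyticAt_formalField_left (hF : ∀ k, AnalyticAt ℂ (F k) x) (N n : ℕ) (i : Fin s) :
    AnalyticAt ℂ (fun τ => Φ.formalField F N n i (τ, x)) 0 :=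
  AnalyticAt.fun_comp (f := fun τ : ℂ => (τ, x)) (analyticAt_formalField hF N n i)
    (analyticAt_id.prod analyticAt_const)

theorem analyticAt_numCoeffSucc (hF : ∀ k, AnalyticAt ℂ (F k) x) (n : ℕ) :
    AnalyticAt ℂ (Φ.numCoeffSucc F n) x :=
  Finset.analyticAt_fun_sum _ fun i _ => AnalyticAt.fun_const_smul (c := Φ.b i)
    (analyticAt_taylorCoeff (analyticAt_formalField hF (n + 1) n i) n)

theorem isBigO_formalStage_sub (n l : ℕ) (i : Fin s) :
    (fun τ => Φ.formalStage F x (n + l) τ i - Φ.formalStage F x n τ i) =O[𝓝 0]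
      fun τ : ℂ => τ ^ (n + 1) := by
  induction l with
  | zero => simpa using isBigO_zero (E' := CVec D) (fun τ : ℂ => τ ^ (n + 1)) (𝓝 0)
  | succ l ih =>
    have h1 : (fun τ : ℂ => τ ^ (n + l + 1) • ∑ j, Φ.a i j • taylorCoeff (n + l)
        (fun τ => Φ.formalField F (n + l + 1) (n + l) j (τ, x))) =O[𝓝 0]
        fun τ : ℂ => τ ^ (n + 1) := by
      have h2 : (fun τ : ℂ => τ ^ (n + l + 1)) =O[𝓝 0] fun τ : ℂ => τ ^ (n + 1) :=
        (((continuous_pow l).tendsto (0 : ℂ)).isBigO_one ℂ).mul (isBigO_refl _ _)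
          |>.congr (fun τ => by ring) (fun τ => one_mul _)
      simpa using h2.smul (isBigO_const_const (∑ j, Φ.a i j • taylorCoeff (n + l)
        (fun τ => Φ.formalField F (n + l + 1) (n + l) j (τ, x))) (one_ne_zero (α := ℂ)) (𝓝 0))
    refine (ih.add h1).congr_left fun τ => ?_
    rw [← add_assoc n l 1, formalStage_succ]
    abel

/-- The coefficient of `τ ^ n` of the formal field is unaffected by terms of higher order. -/
theorem taylorCoeff_formalField (hF : ∀ k, AnalyticAt ℂ (F k) x) {n N : ℕ} (hn : n < N)
    (i : Fin s) :
    taylorCoeff n (fun τ => Φ.formalField F N N i (τ, x)) =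
      taylorCoeff n (fun τ => Φ.formalField F (n + 1) n i (τ, x)) := by
  obtain ⟨l, rfl⟩ := Nat.exists_eq_add_of_le (Nat.succ_le_of_lt hn)
  refine taylorCoeff_congr_of_isBigO (analyticAt_formalField_left hF _ _ i)
    (analyticAt_formalField_left hF _ _ i) ?_
  have hVt : ∀ m, Tendsto (fun τ => Φ.formalStage F x m τ i) (𝓝 0) (𝓝 x) := fun m =>
    (tendsto_formalStage hF m i).comp tendsto_prodMk_nhds_zero
  have h1 : (fun τ : ℂ => ∑ k ∈ Finset.range (n + 1),
      τ ^ k • (F k (Φ.formalStage F x (n + 1 + l) τ i) - F k (Φ.formalStage F x n τ i)))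
      =O[𝓝 0] fun τ : ℂ => τ ^ (n + 1) := by
    refine IsBigO.fun_sum fun k _ => ?_
    have hpow : (fun τ : ℂ => τ ^ k) =O[𝓝 0] fun _ => (1 : ℂ) :=
      ((continuous_pow k).tendsto (0 : ℂ)).isBigO_one ℂ
    have hlip := (hF k).hasStrictFDerivAt.isBigO_sub.comp_tendsto
      ((hVt (n + 1 + l)).prodMk_nhds (hVt n))
    have hst : (fun τ => Φ.formalStage F x (n + 1 + l) τ i - Φ.formalStage F x n τ i) =O[𝓝 0]
        fun τ : ℂ => τ ^ (n + 1) := by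
      rw [add_assoc]
      exact isBigO_formalStage_sub n (1 + l) i
    simpa using hpow.smul (hlip.trans hst)
  have h2 : (fun τ : ℂ => ∑ k ∈ Finset.range l,
      τ ^ (n + 1 + k) • F (n + 1 + k) (Φ.formalStage F x (n + 1 + l) τ i))
      =O[𝓝 0] fun τ : ℂ => τ ^ (n + 1) := by
    refine IsBigO.fun_sum fun k _ => ?_
    have hb : (fun τ : ℂ => τ ^ k • F (n + 1 + k) (Φ.formalStage F x (n + 1 + l) τ i))
        =O[𝓝 0] fun _ => (1 : ℂ) :=
      (((continuous_pow k).tendsto (0 : ℂ)).smul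
        ((hF (n + 1 + k)).continuousAt.tendsto.comp (hVt (n + 1 + l)))).isBigO_one ℂ
    simpa [pow_add, smul_smul] using (isBigO_refl (fun τ : ℂ => τ ^ (n + 1)) (𝓝 0)).smul hb
  refine (h1.add h2).congr_left fun τ => ?_
  simp only [formalField, Finset.sum_range_add _ (n + 1) l, smul_sub, Finset.sum_sub_distrib]
  abel

theorem formalStage_eq_sum (hF : ∀ k, AnalyticAt ℂ (F k) x) {n N : ℕ} (hn : n ≤ N) (τ : ℂ)
    (i : Fin s) : Φ.formalStage F x n τ i = x + ∑ l ∈ Finset.range n, τ ^ (l + 1) •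
      ∑ j, Φ.a i j • taylorCoeff l (fun τ => Φ.formalField F N N j (τ, x)) := by
  induction n with
  | zero => simp [formalStage]
  | succ n ih =>
    rw [formalStage_succ, ih (by omega), Finset.sum_range_succ, add_assoc]
    simp only [taylorCoeff_formalField hF (show n < N by omega)]

end Analytic

section Uniform

variable {Φ : RungeKutta s} {F : ℕ → CVec D → CVec D} {U : Set (CVec D)} {x : CVec D}

theorem eventually_snd_mem (hU : U ∈ 𝓝 x) : ∀ᶠ p in 𝓝 ((0 : ℂ), x), p.2 ∈ U :=
  (continuous_snd.tendsto ((0 : ℂ), x)).eventually hU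

/-- The formal stages solve the stage equations of the truncated formal field up to a remainder
of the order of the first neglected power, uniformly in the initial value. -/
theorem isBigO_formalStage (hU : U ∈ 𝓝 x) (hF : ∀ k, AnalyticOnNhd ℂ (F k) U) (N : ℕ)
    (i : Fin s) :
    (fun p : ℂ × CVec D => Φ.formalStage F p.2 N p.1 i -
      (p.2 + p.1 • ∑ j, Φ.a i j • Φ.formalField F N N j p)) =O[𝓝 (0, x)]
        fun p => p.1 ^ (N + 1) := by
  have hFx : ∀ k, AnalyticAt ℂ (F k) x := fun k => hF k x (mem_of_mem_nhds hU)
  have h1 : (fun p : ℂ × CVec D => p.1 • ∑ j, Φ.a i j • (Φ.formalField F N N j p -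
      ∑ n ∈ Finset.range N, p.1 ^ n • taylorCoeff n (fun τ => Φ.formalField F N N j (τ, p.2))))
      =O[𝓝 (0, x)] fun p => p.1 ^ (N + 1) := by
    simp only [pow_succ']
    refine (isBigO_refl (fun p : ℂ × CVec D => p.1) _).smul (IsBigO.fun_sum fun j _ => ?_)
    exact (isBigO_sub_taylor (analyticAt_formalField hFx N N j) N).const_smul_left (Φ.a i j)
  refine h1.neg_left.congr' ?_ EventuallyEq.rfl
  filter_upwards [eventually_snd_mem hU] with p hp
  rw [formalStage_eq_sum (fun k => hF k p.2 hp) le_rfl, add_sub_add_left_eq_sub, ← neg_sub,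
    neg_inj]
  simp only [smul_sub, Finset.sum_sub_distrib, Finset.smul_sum, pow_succ']
  congr 1
  rw [Finset.sum_comm]
  refine Finset.sum_congr rfl fun n _ => Finset.sum_congr rfl fun j _ => ?_
  rw [smul_comm (Φ.a i j), smul_smul, smul_comm]

theorem isBigO_numCoeffSucc (hU : U ∈ 𝓝 x) (hF : ∀ k, AnalyticOnNhd ℂ (F k) U) (N : ℕ) :
    (fun p : ℂ × CVec D => p.1 • ∑ i, Φ.b i • Φ.formalField F N N i p -
      ∑ n ∈ Finset.range N, p.1 ^ (n + 1) • Φ.numCoeffSucc F n p.2) =O[𝓝 (0, x)]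
        fun p => p.1 ^ (N + 1) := by
  have hFx : ∀ k, AnalyticAt ℂ (F k) x := fun k => hF k x (mem_of_mem_nhds hU)
  have h1 : (fun p : ℂ × CVec D => p.1 • ∑ j, Φ.b j • (Φ.formalField F N N j p -
      ∑ n ∈ Finset.range N, p.1 ^ n • taylorCoeff n (fun τ => Φ.formalField F N N j (τ, p.2))))
      =O[𝓝 (0, x)] fun p => p.1 ^ (N + 1) := by
    simp only [pow_succ']
    refine (isBigO_refl (fun p : ℂ × CVec D => p.1) _).smul (IsBigO.fun_sum fun j _ => ?_)
    exact (isBigO_sub_taylor (analyticAt_formalField hFx N N j) N).const_smul_left (Φ.b j)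
  refine h1.congr' ?_ EventuallyEq.rfl
  filter_upwards [eventually_snd_mem hU] with p hp
  have h2 : ∀ n ∈ Finset.range N, p.1 ^ (n + 1) • Φ.numCoeffSucc F n p.2 =
      ∑ i, p.1 ^ (n + 1) • Φ.b i •
        taylorCoeff n (fun τ => Φ.formalField F N N i (τ, p.2)) := by
    intro n hn
    rw [numCoeffSucc_eq, Finset.smul_sum]
    refine Finset.sum_congr rfl fun i _ => ?_
    rw [taylorCoeff_formalField (fun k => hF k p.2 hp) (Finset.mem_range.1 hn)]
  rw [Finset.sum_congr rfl h2]
  simp only [smul_sub, Finset.sum_sub_distrib, Finset.smul_sum, pow_succ']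
  congr 1
  rw [Finset.sum_comm]
  refine Finset.sum_congr rfl fun n _ => Finset.sum_congr rfl fun j _ => ?_
  rw [smul_comm (Φ.b j), smul_smul]

end Uniform

section Imde

variable {Φ : RungeKutta s} {f : CVec D → CVec D} {U : Set (CVec D)}

theorem imdeList_eq_zero (Φ : RungeKutta s) (f : CVec D → CVec D) {n k : ℕ} (h : n ≤ k) :
    Φ.imdeList f n k = 0 := by
  induction n with
  | zero => rfl
  | succ n ih =>
    rw [imdeList, Function.update_of_ne (by omega), ih (by omega)]

theorem imdeList_eq_imdeCoeff (Φ : RungeKutta s) (f : CVec D → CVec D) {n k : ℕ} (h : k < n) :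
    Φ.imdeList f n k = Φ.imdeCoeff f k := by
  induction n with
  | zero => omega
  | succ n ih =>
    rcases Nat.lt_succ_iff_lt_or_eq.1 h with h' | rfl
    · rw [imdeList, Function.update_of_ne (by omega), ih h']
    · rfl

theorem imdeCoeff_eq (Φ : RungeKutta s) (f : CVec D → CVec D) (n : ℕ) (y : CVec D) :
    Φ.imdeCoeff f n y = exactCoeff f (n + 1) y - Φ.numCoeffSucc (Φ.imdeList f n) n y := by
  rw [imdeCoeff, imdeList, Function.update_self]

theorem analyticOnNhd_imdeList (hf : AnalyticOnNhd ℂ f U) (n k : ℕ) :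
    AnalyticOnNhd ℂ (Φ.imdeList f n k) U := by
  induction n generalizing k with
  | zero => exact analyticOnNhd_const
  | succ n ih =>
    intro y hy
    rcases eq_or_ne k n with rfl | hk
    · rw [imdeList, Function.update_self]
      exact (analyticOnNhd_exactCoeff hf _ y hy).fun_sub
        (analyticAt_numCoeffSucc (fun k => ih k y hy) _)
    · rw [imdeList, Function.update_of_ne hk]
      exact ih k y hy

theorem analyticOnNhd_imdeCoeff (hf : AnalyticOnNhd ℂ f U) (k : ℕ) :
    AnalyticOnNhd ℂ (Φ.imdeCoeff f k) U :=
  analyticOnNhd_imdeList hf (k + 1) k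

/-- The defining property of the inverse modified equation: by consistency, the coefficient `f_n`
enters the `(n + 1)`-st coefficient of the numerical solution with factor one. -/
theorem numCoeffSucc_imdeCoeff (hΦ : Φ.Consistent) (hf : AnalyticOnNhd ℂ f U) (n : ℕ)
    {y : CVec D} (hy : y ∈ U) :
    Φ.numCoeffSucc (Φ.imdeCoeff f) n y = exactCoeff f (n + 1) y := by
  set F := Φ.imdeCoeff f with hF
  set F' := Φ.imdeList f n with hF'
  have hFy : ∀ k, AnalyticAt ℂ (F k) y := fun k => analyticOnNhd_imdeCoeff hf k y hy
  have hF'y : ∀ k, AnalyticAt ℂ (F' k) y := fun k => analyticOnNhd_imdeList hf n k y hy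
  have hagree : ∀ k < n, F k = F' k := fun k hk => (Φ.imdeList_eq_imdeCoeff f hk).symm
  have hstage := Φ.formalStage_congr hagree y
  have hcoeff : ∀ i, taylorCoeff n (fun τ => Φ.formalField F (n + 1) n i (τ, y)) =
      taylorCoeff n (fun τ => Φ.formalField F' (n + 1) n i (τ, y)) + F n y := by
    intro i
    have hdiff : ∀ τ : ℂ, Φ.formalField F (n + 1) n i (τ, y) =
        Φ.formalField F' (n + 1) n i (τ, y) + τ ^ n • F n (Φ.formalStage F y n τ i) := by
      intro τ
      rw [formalField, formalField, Finset.sum_range_succ, Finset.sum_range_succ,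
        hF', Φ.imdeList_eq_zero f le_rfl, ← hF', Pi.zero_apply, smul_zero, add_zero]
      congr 1
      refine Finset.sum_congr rfl fun k hk => ?_
      rw [hagree k (Finset.mem_range.1 hk), hstage]
    have hO := isBigO_sub_taylor (analyticAt_formalField hF'y (n + 1) n i (Φ := Φ)) (n + 1)
      |>.comp_tendsto (tendsto_prodMk_nhds_zero (x := y))
    have hlip := (hFy n).hasStrictFDerivAt.isBigO_sub.comp_tendsto
      (((tendsto_formalStage hFy n i (Φ := Φ)).comp tendsto_prodMk_nhds_zero).prodMk_nhds
        (tendsto_const_nhds (x := y)))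
    have hst : (fun τ : ℂ => Φ.formalStage F y n τ i - y) =O[𝓝 0] fun τ : ℂ => τ := by
      simpa [formalStage] using isBigO_formalStage_sub (Φ := Φ) (F := F) (x := y) 0 n i
    have hO' : (fun τ : ℂ => τ ^ n • (F n (Φ.formalStage F y n τ i) - F n y)) =O[𝓝 0]
        fun τ : ℂ => τ ^ (n + 1) := by
      simpa [pow_succ] using (isBigO_refl (fun τ : ℂ => τ ^ n) (𝓝 0)).smul (hlip.trans hst)
    have := taylorCoeff_eq_of_isBigO (N := n + 1) (j := n)
      (c := fun k => taylorCoeff k (fun τ => Φ.formalField F' (n + 1) n i (τ, y)) +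
        if k = n then F n y else 0)
      (analyticAt_formalField_left hFy (n + 1) n i (Φ := Φ)) ?_ (Nat.lt_succ_self n)
    · simpa using this
    · refine (hO.add hO').congr_left fun τ => ?_
      simp only [Function.comp_apply, hdiff, smul_add, smul_ite, smul_zero,
        Finset.sum_add_distrib, Finset.sum_ite_eq', Finset.mem_range, Nat.lt_succ_self, if_true,
        smul_sub]
      abel
  rw [numCoeffSucc_eq, Finset.sum_congr rfl fun i _ => by rw [hcoeff i]]
  simp only [smul_add, Finset.sum_add_distrib]
  rw [← numCoeffSucc_eq, ← Finset.sum_smul, hΦ, one_smul, hF, imdeCoeff_eq, add_sub_cancel]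

/-- The formal identity `Φ_{τ,f_τ}(y) = φ_{τ,f}(y)`, as an asymptotic relation for the truncated
inverse modified field, uniform in the initial value. -/
theorem isBigO_formal_sub_exact (hΦ : Φ.Consistent) {x : CVec D} (hU : U ∈ 𝓝 x)
    (hf : AnalyticOnNhd ℂ f U) (N : ℕ) :
    (fun p : ℂ × CVec D => p.2 + p.1 • ∑ i, Φ.b i • Φ.formalField (Φ.imdeCoeff f) N N i p -
      ∑ n ∈ Finset.range (N + 1), p.1 ^ n • exactCoeff f n p.2) =O[𝓝 (0, x)]
        fun p => p.1 ^ (N + 1) := by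
  refine (isBigO_numCoeffSucc hU (analyticOnNhd_imdeCoeff hf (Φ := Φ)) N (Φ := Φ)).congr' ?_
    EventuallyEq.rfl
  filter_upwards [eventually_snd_mem hU] with p hp
  rw [Finset.sum_range_succ']
  simp only [numCoeffSucc_imdeCoeff hΦ hf _ hp]
  simp only [exactCoeff, Nat.factorial_zero, Nat.cast_one, inv_one, one_smul,
    Function.iterate_zero, id_eq, pow_zero]
  abel

end Imde

end RungeKutta

/-! ### Comparison of Runge--Kutta orbits of nearby fields -/

namespace RungeKutta

variable {s D : ℕ}

/-- Let `Y` be an orbit of the method for the field `G`, with stages `V`, and let `Z` be an orbit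
for the field `F`, with stages `W`, up to defects of size `‖τ‖ η`. If `F` is Lipschitz, `G - F` is
bounded by `ε`, and `G - F` varies by at most `ω` along the orbit, then the difference of the two
orbits after `S` steps is `S τ (G - F)(y)`, up to an error of higher order in `τ`. -/
theorem norm_orbit_sub_le {Φ : RungeKutta s} (hΦ : Φ.Consistent) {G F : CVec D → CVec D} {S : ℕ}
    {τ : ℂ} {B : Set (CVec D)} {Y Z : ℕ → CVec D} {V W : ℕ → Fin s → CVec D} {ε η ω l : ℝ}
    (hε : 0 ≤ ε) (hη : 0 ≤ η) (hω : 0 ≤ ω) (hl : 0 ≤ l) (h0 : Y 0 = Z 0)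
    (hY : ∀ k < S, Y (k + 1) = Y k + τ • ∑ i, Φ.b i • G (V k i))
    (hV : ∀ k < S, ∀ i, V k i = Y k + τ • ∑ j, Φ.a i j • G (V k j))
    (hZ : ∀ k < S, ‖Z (k + 1) - (Z k + τ • ∑ i, Φ.b i • F (W k i))‖ ≤ ‖τ‖ * η)
    (hW : ∀ k < S, ∀ i, ‖W k i - (Z k + τ • ∑ j, Φ.a i j • F (W k j))‖ ≤ ‖τ‖ * η)
    (hVB : ∀ k < S, ∀ i, V k i ∈ B) (hWB : ∀ k < S, ∀ i, W k i ∈ B)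
    (hGF : ∀ u ∈ B, ‖G u - F u‖ ≤ ε)
    (hGFω : ∀ k < S, ∀ i, ‖G (V k i) - F (V k i) - (G (Y 0) - F (Y 0))‖ ≤ ω)
    (hF : ∀ u ∈ B, ∀ w ∈ B, ‖F u - F w‖ ≤ l * ‖u - w‖)
    (hsmall : 4 * (S * (‖τ‖ * (Φ.size * l))) ≤ 1) :
    ‖Y S - Z S - (S * τ) • (G (Y 0) - F (Y 0))‖ ≤
      S * ‖τ‖ * (Φ.size * ω + 10 * Φ.size ^ 2 * S * l * ‖τ‖ * (ε + η) + η) := by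
  set A := Φ.size with hA
  have hA1 : 1 ≤ A := Φ.one_le_size
  have hτ : 0 ≤ ‖τ‖ := norm_nonneg τ
  set β := 2 * (‖τ‖ * (A * (ε + η))) with hβ
  have hβ0 : 0 ≤ β := by positivity
  set θ := 2 * (‖τ‖ * (A * l)) with hθ
  have hθ0 : 0 ≤ θ := by positivity
  have hθS : ∀ k < S, 2 * (k * θ) ≤ 1 ∧ θ ≤ 1 / 2 := by
    intro k hk
    have hkS : (k : ℝ) ≤ S := by exact_mod_cast hk.le
    have h1S : (1 : ℝ) ≤ S := by exact_mod_cast (Nat.one_le_iff_ne_zero.2 (by omega) : 1 ≤ S)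
    have h1 : (k : ℝ) * θ ≤ S * θ := by gcongr
    have h2 : 1 * θ ≤ S * θ := by gcongr
    have h3 : 2 * (S * θ) ≤ 1 := by rw [hθ]; linarith
    constructor <;> linarith
  have hdiff : ∀ k < S, ∀ i, ‖G (V k i) - F (W k i)‖ ≤ ε + l * ‖V k - W k‖ := by
    intro k hk i
    calc ‖G (V k i) - F (W k i)‖ = ‖(G (V k i) - F (V k i)) + (F (V k i) - F (W k i))‖ := by
          congr 1; abel
      _ ≤ ε + l * ‖V k - W k‖ := by
        refine norm_add_le_of_le (hGF _ (hVB k hk i)) ((hF _ (hVB k hk i) _ (hWB k hk i)).trans ?_)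
        gcongr
        exact norm_le_pi_norm (V k - W k) i
  -- the stages are as close as the initial values of the step
  have hstage : ∀ k < S, ‖V k - W k‖ ≤ 2 * ‖Y k - Z k‖ + β := by
    intro k hk
    have h1 : ‖V k - W k‖ ≤ ‖Y k - Z k‖ + ‖τ‖ * (A * (ε + l * ‖V k - W k‖)) + ‖τ‖ * η := by
      rw [pi_norm_le_iff_of_nonneg (by positivity)]
      intro i
      calc ‖(V k - W k) i‖ = ‖(Y k - Z k) + τ • (∑ j, Φ.a i j • (G (V k j) - F (W k j))) -
            (W k i - (Z k + τ • ∑ j, Φ.a i j • F (W k j)))‖ := by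
            simp only [smul_sub, Finset.sum_sub_distrib]
            rw [Pi.sub_apply]
            congr 1
            nth_rewrite 1 [hV k hk i]
            abel
        _ ≤ ‖Y k - Z k‖ + ‖τ‖ * (A * (ε + l * ‖V k - W k‖)) + ‖τ‖ * η := by
          refine norm_sub_le_of_le (norm_add_le_of_le le_rfl ?_) (hW k hk i)
          rw [norm_smul]
          gcongr
          exact Φ.norm_sum_a_le i (by positivity) (hdiff k hk)
    have h2 := (hθS k hk).2
    have h3 : ‖τ‖ * η ≤ ‖τ‖ * (A * η) := by
      gcongr
      exact le_mul_of_one_le_left hη hA1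
    have h4 : θ * ‖V k - W k‖ ≤ 1 / 2 * ‖V k - W k‖ := by gcongr
    have h5 : ‖τ‖ * (A * (ε + l * ‖V k - W k‖)) = ‖τ‖ * (A * ε) + θ * ‖V k - W k‖ / 2 := by
      rw [hθ]; ring
    have h6 : β = 2 * (‖τ‖ * (A * ε)) + 2 * (‖τ‖ * (A * η)) := by rw [hβ]; ring
    have h7 : 0 ≤ ‖τ‖ * (A * ε) := by positivity
    linarith [norm_nonneg (V k - W k)]
  have hstep : ∀ k < S, Y (k + 1) - Z (k + 1) = (Y k - Z k) +
      τ • (∑ i, Φ.b i • (G (V k i) - F (W k i))) -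
        (Z (k + 1) - (Z k + τ • ∑ i, Φ.b i • F (W k i))) := by
    intro k hk
    simp only [smul_sub, Finset.sum_sub_distrib]
    rw [hY k hk]
    abel
  have hdist : ∀ k ≤ S, ‖Y k - Z k‖ ≤ 2 * k * β := by
    intro k
    induction k with
    | zero => intro _; simp [h0]
    | succ k ih =>
      intro hk
      have h1 := ih (by omega)
      have h2 := hstage k (by omega)
      have h3 := (hθS k (by omega)).1
      have h4 := (hθS k (by omega)).2
      have h5 : ‖Y (k + 1) - Z (k + 1)‖ ≤
          ‖Y k - Z k‖ + ‖τ‖ * (A * (ε + l * ‖V k - W k‖)) + ‖τ‖ * η := by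
        rw [hstep k (by omega)]
        refine norm_sub_le_of_le (norm_add_le_of_le le_rfl ?_) (hZ k (by omega))
        rw [norm_smul]
        gcongr
        exact Φ.norm_sum_b_le (by positivity) (hdiff k (by omega))
      have h6 : ‖τ‖ * (A * (ε + l * ‖V k - W k‖)) =
          ‖τ‖ * (A * ε) + θ * ‖V k - W k‖ / 2 := by rw [hθ]; ring
      have h7 : ‖τ‖ * η ≤ ‖τ‖ * (A * η) := by
        gcongr
        exact le_mul_of_one_le_left hη hA1
      have h8 : β = 2 * (‖τ‖ * (A * ε)) + 2 * (‖τ‖ * (A * η)) := by rw [hβ]; ring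
      have h9 : θ * ‖V k - W k‖ ≤ θ * (2 * (2 * k * β) + β) := by
        gcongr
        linarith
      have h10 : θ * (2 * (2 * k * β) + β) = 2 * (2 * (k * θ) * β) + θ * β := by ring
      have h11 : 2 * (k * θ) * β ≤ 1 * β := by gcongr
      have h12 : θ * β ≤ 1 / 2 * β := by gcongr
      push_cast
      linarith
  have hfinal : ∀ k ≤ S, ‖Y k - Z k - (k * τ) • (G (Y 0) - F (Y 0))‖ ≤
      k * (‖τ‖ * (A * (ω + l * (5 * S * β)) + η)) := by
    intro k
    induction k with
    | zero => intro _; simp [h0]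
    | succ k ih =>
      intro hk
      have h1 := ih (by omega)
      have hkS : (k : ℝ) + 1 ≤ S := by exact_mod_cast hk
      have h2 : ‖V k - W k‖ ≤ 5 * S * β := by
        have := hstage k (by omega)
        have := hdist k (by omega)
        nlinarith
      have h3 : ∀ i, ‖G (V k i) - F (W k i) - (G (Y 0) - F (Y 0))‖ ≤ ω + l * (5 * S * β) := by
        intro i
        calc ‖G (V k i) - F (W k i) - (G (Y 0) - F (Y 0))‖
            = ‖(G (V k i) - F (V k i) - (G (Y 0) - F (Y 0))) + (F (V k i) - F (W k i))‖ := by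
              congr 1; abel
          _ ≤ ω + l * (5 * S * β) := by
            refine norm_add_le_of_le (hGFω k (by omega) i)
              ((hF _ (hVB k (by omega) i) _ (hWB k (by omega) i)).trans ?_)
            gcongr
            exact (norm_le_pi_norm (V k - W k) i).trans h2
      have h4 : Y (k + 1) - Z (k + 1) - (((k + 1 : ℕ) : ℂ) * τ) • (G (Y 0) - F (Y 0)) =
          (Y k - Z k - (k * τ) • (G (Y 0) - F (Y 0))) +
          τ • (∑ i, Φ.b i • (G (V k i) - F (W k i) - (G (Y 0) - F (Y 0)))) -
            (Z (k + 1) - (Z k + τ • ∑ i, Φ.b i • F (W k i))) := by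
        have h5 : ∑ i, Φ.b i • (G (Y 0) - F (Y 0)) = G (Y 0) - F (Y 0) := by
          rw [← Finset.sum_smul, hΦ, one_smul]
        rw [hstep k (by omega)]
        simp only [smul_sub _ _ (G (Y 0) - F (Y 0)), Finset.sum_sub_distrib]
        rw [h5, smul_sub τ]
        push_cast
        rw [add_mul, one_mul, add_smul]
        abel
      rw [h4]
      calc _ ≤ k * (‖τ‖ * (A * (ω + l * (5 * S * β)) + η)) +
            ‖τ‖ * (A * (ω + l * (5 * S * β))) + ‖τ‖ * η := by
            refine norm_sub_le_of_le (norm_add_le_of_le h1 ?_) (hZ k (by omega))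
            rw [norm_smul]
            gcongr
            exact Φ.norm_sum_b_le (by positivity) h3
        _ = (k + 1 : ℕ) * (‖τ‖ * (A * (ω + l * (5 * S * β)) + η)) := by push_cast; ring
  refine (hfinal S le_rfl).trans_eq ?_
  rw [hβ]
  ring

/-- The stage equations and the step for a field `τ • g`, with the factor `τ` pulled out. -/
theorem orbit_smul {Φ : RungeKutta s} {U : Set (CVec D)} {g : CVec D → CVec D} {τ : ℂ}
    {y : CVec D} {k : ℕ}
    (h : ∃ v, Φ.IsStages U (fun u => τ • g u) 1 (Φ.solver U (fun u => τ • g u) 1 k y) v) :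
    (Φ.solver U (fun u => τ • g u) 1 (k + 1) y = Φ.solver U (fun u => τ • g u) 1 k y +
      τ • ∑ i, Φ.b i •
        g (Φ.stages U (fun u => τ • g u) (Φ.solver U (fun u => τ • g u) 1 k y) i)) ∧
    ∀ i, Φ.stages U (fun u => τ • g u) (Φ.solver U (fun u => τ • g u) 1 k y) i =
      Φ.solver U (fun u => τ • g u) 1 k y + τ • ∑ j, Φ.a i j •
        g (Φ.stages U (fun u => τ • g u) (Φ.solver U (fun u => τ • g u) 1 k y) j) := by
  constructor
  · rw [solver_succ, step_eq h]
    simp only [Finset.smul_sum, smul_comm τ]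
  · intro i
    have := (isStages_stages h i).2
    simpa only [one_smul, Finset.smul_sum, smul_comm τ] using this

end RungeKutta

/-! ### The correction step -/

namespace RungeKutta

variable {s D : ℕ}

/-- One step of the iteration for the modified field: the field `G τ` is corrected by the error
`(Φ_{τ,G}^S(y) - φ_{Sτ,f}(y)) / (Sτ)`. The set `U` carries `f` and `V` carries `G`. -/
noncomputable def correction (Φ : RungeKutta s) (U V : Set (CVec D)) (f : CVec D → CVec D) (S : ℕ)
    (G : ℂ → CVec D → CVec D) (τ : ℂ) (y : CVec D) : CVec D :=
  G τ y - (S : ℂ)⁻¹ • (Φ.increment V G S τ y - flowIncrement U f S τ y)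

section Correction

variable {Φ : RungeKutta s} {U V V' : Set (CVec D)} {f : CVec D → CVec D} {S : ℕ}
  {G : ℂ → CVec D → CVec D} {δ ε m : ℝ}

/-- Consequences of the smallness of the parameter `τ` relative to `δ / m`. -/
theorem step_size_bounds (hδ : 0 < δ) (hm : 0 < m) (hS : 1 ≤ S)
    (hsmall : 300 * Φ.size ^ 2 * S * (ε * m) ≤ δ) {t : ℝ} (ht0 : 0 ≤ t) (ht : t ≤ ε) :
    16 * (S * (Φ.size * (t * (2 * m)))) ≤ δ ∧ 16 * (S * (Φ.size * (t * m))) ≤ δ ∧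
      8 * (S * (t * m)) ≤ δ ∧ 300 * Φ.size ^ 2 * S * (t * m) ≤ δ := by
  have hA := Φ.one_le_size
  have hS' : (1 : ℝ) ≤ S := by exact_mod_cast hS
  have h1 : 300 * Φ.size ^ 2 * S * (t * m) ≤ 300 * Φ.size ^ 2 * S * (ε * m) := by gcongr
  have h0 : 0 ≤ S * (t * m) := by positivity
  have h2 : S * (t * m) * 1 ≤ S * (t * m) * Φ.size := by gcongr
  have h3 : S * (t * m) * Φ.size * 1 ≤ S * (t * m) * Φ.size * Φ.size := by gcongr
  refine ⟨?_, ?_, ?_, ?_⟩ <;> nlinarith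

theorem holomorphicFamily_correction (hδ : 0 < δ) (hm : 0 < m) (hS : 1 ≤ S)
    (hf : HolomorphicAlong U f) (hfm : ∀ u ∈ U, ‖f u‖ ≤ m) (hG : HolomorphicFamily ε V G)
    (hGm : ∀ τ ∈ ball (0 : ℂ) ε, ∀ u ∈ V, ‖G τ u‖ ≤ 2 * m) (hV : ∀ y ∈ V', ball y δ ⊆ V)
    (hVU : V ⊆ U) (hε : 0 ≤ ε) (hsmall : 300 * Φ.size ^ 2 * S * (ε * m) ≤ δ) :
    HolomorphicFamily ε V' (Φ.correction U V f S G) := by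
  obtain ⟨hs1, -, hs3, -⟩ := step_size_bounds hδ hm hS hsmall hε le_rfl
  have hinc : HolomorphicFamily ε V' (Φ.increment V G S) := by
    refine holomorphicFamily_increment (β := ε * (2 * m)) hδ (by positivity) hG
      (fun τ hτ u hu => ?_) hS hs1 hV
    rw [norm_smul]
    have : ‖τ‖ ≤ ε := by simpa using (mem_ball_zero_iff.1 hτ).le
    gcongr
    exact hGm τ hτ u hu
  have hflow : HolomorphicFamily ε V' (flowIncrement U f S) :=
    holomorphicFamily_flowIncrement hδ hm.le hf hfm hs3 fun y hy => (hV y hy).trans hVU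
  intro W τ u hW hτ hu hτε huV
  refine (hG W τ u hW hτ hu hτε fun t ht => hV _ (huV t ht) (mem_ball_self hδ)).sub ?_
  exact ((hinc W τ u hW hτ hu hτε huV).sub (hflow W τ u hW hτ hu hτε huV)).fun_const_smul _

theorem norm_correction_le (hΦ : Φ.Consistent) (hδ : 0 < δ) (hm : 0 < m) (hS : 1 ≤ S)
    (hf : HolomorphicAlong U f) (hfm : ∀ u ∈ U, ‖f u‖ ≤ m) (hG : HolomorphicFamily ε V G)
    (hGm : ∀ τ ∈ ball (0 : ℂ) ε, ∀ u ∈ V, ‖G τ u‖ ≤ 2 * m) (hV : ∀ y ∈ V', ball y δ ⊆ V)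
    (hVU : V ⊆ U) (hsmall : 300 * Φ.size ^ 2 * S * (ε * m) ≤ δ) {τ : ℂ}
    (hτ : τ ∈ ball (0 : ℂ) ε) {y : CVec D} (hy : y ∈ V') :
    ‖Φ.correction U V f S G τ y‖ ≤ 2 * m := by
  have hτε : ‖τ‖ ≤ ε := by simpa using (mem_ball_zero_iff.1 hτ).le
  obtain ⟨hs1, -, hs3, hs4⟩ := step_size_bounds hδ hm hS hsmall (norm_nonneg τ) hτε
  have hA := Φ.one_le_size
  have hS' : (1 : ℝ) ≤ S := by exact_mod_cast hS
  have hSne : (S : ℂ) ≠ 0 := by exact_mod_cast (by omega : S ≠ 0)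
  have hGτ := hG.holomorphicAlong hτ
  have hflow := norm_flowIncrement_le hδ hm.le ((hV y hy).trans hVU) hf hfm hs3
  have hterm : ∀ k < S, ∀ i,
      ‖G τ (Φ.stages V (fun u => τ • G τ u) (Φ.solver V (fun u => τ • G τ u) 1 k y) i) - G τ y‖ ≤
        4 * (2 * m) / δ * (S * (Φ.size * (‖τ‖ * (2 * m)))) := by
    intro k hk i
    have h1 := norm_stages_sub_le hδ (by positivity) (hV y hy) (hGτ.const_smul τ)
      (norm_smul_field_le (hGm τ hτ) τ) hS hs1 hk i (Φ := Φ)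
    refine ((hGτ.mono (hV y hy)).norm_sub_le (fun u hu => hGm τ hτ u (hV y hy hu)) ?_
      (mem_ball_self (half_pos hδ))).trans (by gcongr)
    rw [mem_ball_iff_norm]
    linarith
  have hinc : ‖Φ.increment V G S τ y - (S : ℂ) • G τ y‖ ≤ S * m := by
    have h1 : Φ.increment V G S τ y - (S : ℂ) • G τ y = ∑ k ∈ Finset.range S, ∑ i, Φ.b i •
        (G τ (Φ.stages V (fun u => τ • G τ u) (Φ.solver V (fun u => τ • G τ u) 1 k y) i) -
          G τ y) := by
      simp only [smul_sub, Finset.sum_sub_distrib, ← Finset.sum_smul, increment]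
      rw [hΦ]
      simp only [Finset.sum_const, Finset.card_range, nsmul_eq_mul, mul_one,
        Nat.cast_smul_eq_nsmul]
    rw [h1]
    calc _ ≤ ∑ k ∈ Finset.range S,
          Φ.size * (4 * (2 * m) / δ * (S * (Φ.size * (‖τ‖ * (2 * m))))) :=
          norm_sum_le_of_le _ fun k hk =>
            Φ.norm_sum_b_le (by positivity) (hterm k (Finset.mem_range.1 hk))
      _ = S * (16 * Φ.size ^ 2 * S * (‖τ‖ * m) / δ * m) := by
        rw [Finset.sum_const, Finset.card_range, nsmul_eq_mul]
        ring
      _ ≤ S * (1 * m) := by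
        gcongr
        rw [div_le_one hδ]
        have : 0 ≤ Φ.size ^ 2 * S * (‖τ‖ * m) := by positivity
        linarith
      _ = S * m := by ring
  have heq : Φ.correction U V f S G τ y = (S : ℂ)⁻¹ •
      (flowIncrement U f S τ y - (Φ.increment V G S τ y - (S : ℂ) • G τ y)) := by
    rw [correction, smul_sub, smul_sub, smul_sub, inv_smul_smul₀ hSne]
    abel
  rw [heq, norm_smul, norm_inv, Complex.norm_natCast, inv_mul_le_iff₀ (by linarith)]
  calc _ ≤ S * m + S * m := norm_sub_le_of_le hflow hinc
    _ = S * (2 * m) := by ring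

theorem correction_eq {τ : ℂ} (hτ0 : τ ≠ 0) (hδ : 0 < δ) (hm : 0 < m) (hS : 1 ≤ S)
    (hG : HolomorphicAlong V (G τ)) (hGm : ∀ u ∈ V, ‖G τ u‖ ≤ 2 * m)
    (hsmall : 16 * (S * (Φ.size * (‖τ‖ * (2 * m)))) ≤ δ) {y : CVec D} (hV : ball y δ ⊆ V) :
    Φ.correction U V f S G τ y = G τ y - (S * τ)⁻¹ •
      (Φ.solver V (fun u => τ • G τ u) 1 S y - flow U (fun u => τ • f u) S y) := by
  rw [correction, flow_eq_add_smul_flowIncrement hτ0, solver_eq_add_smul_increment hδ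
    (by positivity) hV hG (norm_smul_field_le hGm τ) hS hsmall, add_sub_add_left_eq_sub,
    ← smul_sub, smul_smul, mul_inv, mul_assoc, inv_mul_cancel₀ hτ0, mul_one]

/-- The correction step contracts the distance to any field `g`, up to the error of the solver for
`g`. The loss of domain `δ` pays for the derivatives of `g - G τ`. -/
theorem norm_sub_correction_le (hΦ : Φ.Consistent) (hδ : 0 < δ) (hm : 0 < m) (hS : 1 ≤ S)
    {g : CVec D → CVec D} (hg : HolomorphicAlong U g) (hgm : ∀ u ∈ U, ‖g u‖ ≤ m)
    (hG : HolomorphicFamily ε V G)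
    (hGm : ∀ τ ∈ ball (0 : ℂ) ε, ∀ u ∈ V, ‖G τ u‖ ≤ 2 * m) (hV : ∀ y ∈ V', ball y δ ⊆ V)
    (hVU : V ⊆ U) (hsmall : 300 * Φ.size ^ 2 * S * (ε * m) ≤ δ) {τ : ℂ} (hτ0 : τ ≠ 0)
    (hτ : τ ∈ ball (0 : ℂ) ε) {b : ℝ} (hb : ∀ u ∈ V, ‖g u - G τ u‖ ≤ b) {y : CVec D}
    (hy : y ∈ V') :
    ‖g y - Φ.correction U V f S G τ y‖ ≤ (Real.exp 1)⁻¹ * b +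
      ‖Φ.solver U (fun u => τ • g u) 1 S y - flow U (fun u => τ • f u) S y‖ / (S * ‖τ‖) := by
  have hτε : ‖τ‖ ≤ ε := by simpa using (mem_ball_zero_iff.1 hτ).le
  obtain ⟨hs1, hs2, -, hs4⟩ := step_size_bounds hδ hm hS hsmall (norm_nonneg τ) hτε
  have hA := Φ.one_le_size
  have hS' : (1 : ℝ) ≤ S := by exact_mod_cast hS
  have hτpos : 0 < ‖τ‖ := norm_pos_iff.2 hτ0
  have hyV := hV y hy
  have hyU := hyV.trans hVU
  have hGτ := hG.holomorphicAlong hτ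
  have hb0 : 0 ≤ b := (norm_nonneg _).trans (hb y (hyV (mem_ball_self hδ)))
  have hspecY : ∀ k < S, _ := fun k hk => orbit_smul (solver_spec hδ (by positivity) hyU
    (hg.const_smul τ) (norm_smul_field_le hgm τ) hS hs2 (le_of_lt hk) (Φ := Φ) (k := k)).2.2.exists
  have hspecZ : ∀ k < S, _ := fun k hk => orbit_smul (solver_spec hδ (by positivity) hyV
    (hGτ.const_smul τ) (norm_smul_field_le (hGm τ hτ) τ) hS hs1 (le_of_lt hk)
    (Φ := Φ) (k := k)).2.2.exists
  have hVst := fun k hk i => norm_stages_sub_le hδ (by positivity) hyU (hg.const_smul τ)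
    (norm_smul_field_le hgm τ) hS hs2 hk i (Φ := Φ) (k := k)
  have hWst := fun k hk i => norm_stages_sub_le hδ (by positivity) hyV (hGτ.const_smul τ)
    (norm_smul_field_le (hGm τ hτ) τ) hS hs1 hk i (Φ := Φ) (k := k)
  have hE : HolomorphicAlong (ball y δ) (fun u => g u - G τ u) :=
    (hg.mono hyU).sub (hGτ.mono hyV)
  have hcomp := norm_orbit_sub_le hΦ (G := g) (F := G τ) (S := S) (τ := τ) (B := ball y (δ / 2))
    (Y := fun k => Φ.solver U (fun u => τ • g u) 1 k y)
    (Z := fun k => Φ.solver V (fun u => τ • G τ u) 1 k y)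
    (V := fun k => Φ.stages U (fun u => τ • g u) (Φ.solver U (fun u => τ • g u) 1 k y))
    (W := fun k => Φ.stages V (fun u => τ • G τ u) (Φ.solver V (fun u => τ • G τ u) 1 k y))
    (ε := b) (η := 0) (ω := 4 * b / δ * (S * (Φ.size * (‖τ‖ * m)))) (l := 4 * (2 * m) / δ)
    hb0 le_rfl (by positivity) (by positivity) rfl
    (fun k hk => (hspecY k hk).1) (fun k hk => (hspecY k hk).2)
    (fun k hk => by simp only [(hspecZ k hk).1, sub_self, norm_zero, mul_zero, le_refl])
    (fun k hk i => by
      rw [← (hspecZ k hk).2 i, sub_self, norm_zero, mul_zero])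
    (fun k hk i => by rw [mem_ball_iff_norm]; linarith [hVst k hk i])
    (fun k hk i => by rw [mem_ball_iff_norm]; linarith [hWst k hk i])
    (fun u hu => hb u (hyV (ball_subset_ball (by linarith) hu)))
    (fun k hk i => by
      refine (hE.norm_sub_le (fun u hu => hb u (hyV hu)) (w := y) ?_
        (mem_ball_self (half_pos hδ))).trans ?_
      · rw [mem_ball_iff_norm]; linarith [hVst k hk i]
      · have := hVst k hk i
        gcongr)
    (fun u hu w hw =>
      (hGτ.mono hyV).norm_sub_le (fun u hu => hGm τ hτ u (hyV hu)) hu hw)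
    (by
      rw [mul_div_assoc', mul_div_assoc', mul_div_assoc', mul_div_assoc', div_le_one hδ]
      linarith)
  have hYS : ‖Φ.solver U (fun u => τ • g u) 1 S y - Φ.solver V (fun u => τ • G τ u) 1 S y -
      (S * τ) • (g y - G τ y)‖ ≤ S * ‖τ‖ * ((Real.exp 1)⁻¹ * b) := by
    refine hcomp.trans ?_
    have hexp : 84 / 300 ≤ (Real.exp 1)⁻¹ := by
      rw [le_inv_comm₀ (by norm_num) (Real.exp_pos 1)]
      linarith [Real.exp_one_lt_d9]
    have h1 : 0 ≤ Φ.size ^ 2 * S * (‖τ‖ * m) := by positivity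
    gcongr
    calc _ = 84 * (Φ.size ^ 2 * S * (‖τ‖ * m)) / δ * b := by ring
      _ ≤ 84 / 300 * b := by
        refine mul_le_mul_of_nonneg_right ?_ hb0
        rw [div_le_iff₀ hδ]
        linarith
      _ ≤ (Real.exp 1)⁻¹ * b := by gcongr
  have hSτ : ((S : ℂ) * τ) ≠ 0 := mul_ne_zero (by exact_mod_cast (by omega : S ≠ 0)) hτ0
  have hn : ‖(S : ℂ) * τ‖ = S * ‖τ‖ := by rw [norm_mul, Complex.norm_natCast]
  have hpos : 0 < S * ‖τ‖ := by positivity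
  have heq : ((S : ℂ) * τ) • (g y - Φ.correction U V f S G τ y) =
      (Φ.solver U (fun u => τ • g u) 1 S y - flow U (fun u => τ • f u) S y) -
      (Φ.solver U (fun u => τ • g u) 1 S y - Φ.solver V (fun u => τ • G τ u) 1 S y -
      (S * τ) • (g y - G τ y)) := by
    rw [correction_eq hτ0 hδ hm hS hGτ (hGm τ hτ) hs1 hyV, ← sub_add, smul_add, smul_smul,
      mul_inv_cancel₀ hSτ, one_smul]
    abel
  rw [← mul_le_mul_iff_right₀ hpos]
  calc S * ‖τ‖ * ‖g y - Φ.correction U V f S G τ y‖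
      = ‖((S : ℂ) * τ) • (g y - Φ.correction U V f S G τ y)‖ := by rw [norm_smul, hn]
    _ ≤ ‖Φ.solver U (fun u => τ • g u) 1 S y - flow U (fun u => τ • f u) S y‖ +
        S * ‖τ‖ * ((Real.exp 1)⁻¹ * b) := by
      rw [heq]
      exact norm_sub_le_of_le le_rfl hYS
    _ = _ := by field_simp; ring

end Correction

end RungeKutta

/-! ### The iterates agree with the inverse modified field to increasing order -/

namespace RungeKutta

variable {s D : ℕ}

/-- The partial sum `∑ k < N, τ ^ k f_k` of the inverse modified field, for complex `τ`. -/
noncomputable def imdeSum (Φ : RungeKutta s) (f : CVec D → CVec D) (N : ℕ) (τ : ℂ) (y : CVec D) :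
    CVec D :=
  ∑ k ∈ Finset.range N, τ ^ k • Φ.imdeCoeff f k y

section Order

variable {Φ : RungeKutta s} {U V V' : Set (CVec D)} {f : CVec D → CVec D} {S N : ℕ}
  {G : ℂ → CVec D → CVec D} {δ ε m : ℝ} {x : CVec D}

theorem analyticAt_imdeSum (hf : AnalyticOnNhd ℂ f U) (N : ℕ) {p : ℂ × CVec D} (hp : p.2 ∈ U) :
    AnalyticAt ℂ (fun p : ℂ × CVec D => Φ.imdeSum f N p.1 p.2) p :=
  Finset.analyticAt_fun_sum _ fun k _ => (analyticAt_fst.fun_pow k).fun_smul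
    (AnalyticAt.fun_comp (f := fun p : ℂ × CVec D => p.2) (analyticOnNhd_imdeCoeff hf k p.2 hp)
      analyticAt_snd)

theorem analyticOnNhd_imdeSum (hf : AnalyticOnNhd ℂ f U) (N : ℕ) (τ : ℂ) :
    AnalyticOnNhd ℂ (Φ.imdeSum f N τ) U := fun y hy =>
  Finset.analyticAt_fun_sum _ fun k _ =>
    (analyticOnNhd_imdeCoeff hf k y hy).fun_const_smul (c := τ ^ k)

/-- If `G` agrees with the inverse modified field up to `O(τ ^ n)`, then the corrected field agrees
with it up to `O(τ ^ (n + 1))`. -/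
theorem isBigO_correction_sub (hΦ : Φ.Consistent) (hδ : 0 < δ) (hm : 0 < m) (hS : 1 ≤ S)
    (hf : AnalyticOnNhd ℂ f U) (hfm : ∀ u ∈ U, ‖f u‖ ≤ m) (hG : HolomorphicFamily ε V G)
    (hGm : ∀ τ ∈ ball (0 : ℂ) ε, ∀ u ∈ V, ‖G τ u‖ ≤ 2 * m) (hV : ∀ y ∈ V', ball y δ ⊆ V)
    (hVU : V ⊆ U) (hε : 0 < ε) (hsmall : 300 * Φ.size ^ 2 * S * (ε * m) ≤ δ) (hx : V' ∈ 𝓝 x)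
    {n : ℕ} (hn : n < N)
    (hO : (fun p : ℂ × CVec D => G p.1 p.2 - Φ.imdeSum f N p.1 p.2) =O[𝓝 (0, x)]
      fun p => p.1 ^ n) :
    (fun p : ℂ × CVec D => Φ.correction U V f S G p.1 p.2 - Φ.imdeSum f N p.1 p.2)
      =O[𝓝 (0, x)] fun p => p.1 ^ (n + 1) := by
  have hA := Φ.one_le_size
  have hS' : (1 : ℝ) ≤ S := by exact_mod_cast hS
  have hV'V : V' ⊆ V := fun y hy => hV y hy (mem_ball_self hδ)
  have hU : U ∈ 𝓝 x := mem_of_superset hx (hV'V.trans hVU)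
  have hxU : x ∈ U := mem_of_mem_nhds hU
  have hcF := analyticOnNhd_imdeCoeff hf (Φ := Φ)
  -- asymptotic relations, with explicit constants
  obtain ⟨C, hC, hGF⟩ := hO.exists_pos
  obtain ⟨C₁, hC₁, hst⟩ :=
    (isBigO_pi.2 fun i => isBigO_formalStage hU hcF N i (Φ := Φ)).exists_pos
  obtain ⟨C₂, hC₂, hnum⟩ := (isBigO_formal_sub_exact hΦ hU hf N).exists_pos
  set L : CVec D → CVec D := (lieDeriv f)^[N + 1] id with hL
  have hLc : ContinuousAt L x := (analyticOnNhd_iterate_lieDeriv hf (N + 1) x hxU).continuousAt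
  set C₃ := ‖L x‖ + 1 with hC₃
  have hF0 := analyticAt_imdeSum hf N (Φ := Φ) (p := ((0 : ℂ), x)) hxU
  set M := ‖Φ.imdeSum f N 0 x‖ + 1 with hM
  have hev : ∀ᶠ p : ℂ × CVec D in 𝓝 (0, x),
      ‖G p.1 p.2 - Φ.imdeSum f N p.1 p.2‖ ≤ C * ‖p.1 ^ n‖ ∧
      ‖Φ.imdeSum f N p.1 p.2‖ ≤ M ∧ ‖L p.2‖ ≤ C₃ ∧ p.2 ∈ V' ∧
      (‖fun i => Φ.formalStage (Φ.imdeCoeff f) p.2 N p.1 i - (p.2 + p.1 • ∑ j, Φ.a i j •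
        Φ.formalField (Φ.imdeCoeff f) N N j p)‖ ≤ C₁ * ‖p.1 ^ (N + 1)‖) ∧
      (‖p.2 + p.1 • ∑ i, Φ.b i • Φ.formalField (Φ.imdeCoeff f) N N i p -
        ∑ n ∈ Finset.range (N + 1), p.1 ^ n • exactCoeff f n p.2‖ ≤ C₂ * ‖p.1 ^ (N + 1)‖) := by
    filter_upwards [hGF.bound, hF0.continuousAt.norm.eventually_le_const (lt_add_one _),
      (continuous_snd.tendsto ((0 : ℂ), x)).eventually
        (hLc.norm.eventually_le_const (lt_add_one _)), eventually_snd_mem hx, hst.bound,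
      hnum.bound] with p h1 h2 h3 h4 h5 h6
    exact ⟨h1, h2, h3, h4, h5, h6⟩
  obtain ⟨r₀, hr₀, hball₀⟩ := Metric.eventually_nhds_iff_ball.1 hev
  have hmem₀ : ∀ {τ : ℂ} {u : CVec D}, ‖τ‖ < r₀ → u ∈ ball x r₀ → (τ, u) ∈ ball ((0 : ℂ), x) r₀ := by
    intro τ u hτ hu
    rw [← ball_prod_same]
    exact ⟨mem_ball_zero_iff.2 hτ, hu⟩
  obtain ⟨r₁, hr₁, hball₁⟩ := Metric.eventually_nhds_iff_ball.1
    ((eventually_all.2 fun i => (tendsto_formalStage (fun k => hcF k x hxU) N i (Φ := Φ)).eventually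
      (ball_mem_nhds x (half_pos hr₀))) : ∀ᶠ p : ℂ × CVec D in 𝓝 (0, x), ∀ i,
        Φ.formalStage (Φ.imdeCoeff f) p.2 N p.1 i ∈ ball x (r₀ / 2))
  have hmem₁ : ∀ {τ : ℂ} {u : CVec D}, ‖τ‖ < r₁ → u ∈ ball x r₁ → (τ, u) ∈ ball ((0 : ℂ), x) r₁ := by
    intro τ u hτ hu
    rw [← ball_prod_same]
    exact ⟨mem_ball_zero_iff.2 hτ, hu⟩
  set l := 4 * M / r₀ with hl
  have hM0 : 0 ≤ M := by positivity
  have hC₃0 : 0 ≤ C₃ := by positivity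
  set C' := C₁ + C₂ + C₃ with hC'
  set K := Φ.size * (4 * C / r₀ * (S * (Φ.size * (2 * m)))) +
    10 * Φ.size ^ 2 * S * l * (C + C') + C' with hK
  have hK0 : 0 ≤ K := by positivity
  -- the bound for `τ ≠ 0`
  have hmain : ∀ᶠ p : ℂ × CVec D in 𝓝 (0, x), p.1 ≠ 0 →
      ‖Φ.correction U V f S G p.1 p.2 - Φ.imdeSum f N p.1 p.2‖ ≤ K * ‖p.1‖ ^ (n + 1) := by
    have hev1 : ∀ᶠ p : ℂ × CVec D in 𝓝 (0, x),
        ‖p.2 - x‖ + S * (Φ.size * (‖p.1‖ * (2 * m))) < min (r₀ / 2) r₁ := by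
      have hc : Continuous fun p : ℂ × CVec D =>
          ‖p.2 - x‖ + S * (Φ.size * (‖p.1‖ * (2 * m))) := by fun_prop
      refine hc.continuousAt.eventually_lt_const ?_
      simpa using ⟨hr₀, hr₁⟩
    have hev2 : ∀ᶠ p : ℂ × CVec D in 𝓝 (0, x), 4 * (S * (‖p.1‖ * (Φ.size * l))) < 1 := by
      have hc : Continuous fun p : ℂ × CVec D => 4 * (S * (‖p.1‖ * (Φ.size * l))) := by fun_prop
      refine hc.continuousAt.eventually_lt_const ?_
      simp
    have hev3 : ∀ᶠ p : ℂ × CVec D in 𝓝 (0, x), ‖p.1‖ < min (min r₀ r₁) (min ε 1) := by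
      have hc : Continuous fun p : ℂ × CVec D => ‖p.1‖ := by fun_prop
      refine hc.continuousAt.eventually_lt_const ?_
      simpa using ⟨⟨hr₀, hr₁⟩, hε⟩
    filter_upwards [hev1, hev2, hev3, eventually_snd_mem hx] with p h1 h2 h3 hyV' hτ0
    obtain ⟨τ, y⟩ := p
    simp only [lt_min_iff] at h1 h2 h3 hyV' hτ0 ⊢
    obtain ⟨⟨hτr₀, hτr₁⟩, hτε, hτ1⟩ := h3
    have hτ : τ ∈ ball (0 : ℂ) ε := mem_ball_zero_iff.2 hτε
    obtain ⟨hs1, hs2, hs3, -⟩ := step_size_bounds hδ hm hS hsmall (norm_nonneg τ) hτε.le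
    have hyV := hV y hyV'
    have hyU := hyV.trans hVU
    have hGτ := hG.holomorphicAlong hτ
    have hdrift : ∀ u : CVec D, ‖u - y‖ ≤ S * (Φ.size * (‖τ‖ * (2 * m))) →
        u ∈ ball x (r₀ / 2) ∧ u ∈ ball x r₁ := by
      intro u hu
      have : ‖u - x‖ ≤ ‖u - y‖ + ‖y - x‖ := norm_sub_le_norm_sub_add_norm_sub u y x
      constructor <;> rw [mem_ball_iff_norm]
      · linarith [h1.1]
      · linarith [h1.2]
    have hhalf : ball x (r₀ / 2) ⊆ ball x r₀ := ball_subset_ball (by linarith)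
    have hV'ball : ball x r₀ ⊆ V' := fun u hu => (hball₀ _ (hmem₀ hτr₀ hu)).2.2.2.1
    obtain ⟨c, hc⟩ := (flowDefinedAt_smul hδ hm.le hyU hf.holomorphicAlong hfm hs3).1
    have hcflow : flow U (fun u => τ • f u) S y = c S :=
      (flowDefinedAt_smul hδ hm.le hyU hf.holomorphicAlong hfm hs3).flow_eq (by positivity) hc
    have hcball : ∀ r ∈ Set.Icc (0 : ℝ) S, c r ∈ ball x (r₀ / 2) ∧ c r ∈ ball x r₁ := by
      intro r hr
      have h4 := hc.mem_closedBall (by positivity) (norm_smul_field_le hfm τ) hr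
      rw [mem_closedBall_iff_norm] at h4
      refine hdrift _ (h4.trans ?_)
      have h5 : 0 ≤ S * (‖τ‖ * m) := by positivity
      nlinarith
    have hkS : ∀ k < S, (k : ℝ) ∈ Set.Icc (0 : ℝ) S := fun k hk =>
      ⟨by positivity, by exact_mod_cast hk.le⟩
    have hspec : ∀ k < S, _ := fun k hk => orbit_smul (solver_spec hδ (by positivity) hyV
      (hGτ.const_smul τ) (norm_smul_field_le (hGm τ hτ) τ) hS hs1 (le_of_lt hk)
      (Φ := Φ) (k := k)).2.2.exists
    have hVst := fun k hk i => norm_stages_sub_le hδ (by positivity) hyV (hGτ.const_smul τ)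
      (norm_smul_field_le (hGm τ hτ) τ) hS hs1 hk i (Φ := Φ) (k := k)
    have hFτ : HolomorphicAlong (ball x r₀) (Φ.imdeSum f N τ) :=
      ((analyticOnNhd_imdeSum hf N τ).holomorphicAlong).mono
        (hV'ball.trans (hV'V.trans hVU))
    have hE : HolomorphicAlong (ball x r₀) (fun u => G τ u - Φ.imdeSum f N τ u) :=
      (hGτ.mono (hV'ball.trans hV'V)).sub hFτ
    have hEbound : ∀ u ∈ ball x r₀, ‖G τ u - Φ.imdeSum f N τ u‖ ≤ C * ‖τ‖ ^ n := fun u hu => by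
      rw [← norm_pow]
      exact (hball₀ _ (hmem₀ hτr₀ hu)).1
    have hFbound : ∀ u ∈ ball x r₀, ‖Φ.imdeSum f N τ u‖ ≤ M := fun u hu =>
      (hball₀ _ (hmem₀ hτr₀ hu)).2.1
    have hpow : ‖τ‖ ^ N ≤ ‖τ‖ ^ (n + 1) := pow_le_pow_of_le_one (norm_nonneg τ) hτ1.le hn
    have hpow' : ‖τ‖ ^ N ≤ ‖τ‖ ^ n := pow_le_pow_of_le_one (norm_nonneg τ) hτ1.le hn.le
    have hcomp := norm_orbit_sub_le hΦ (G := G τ) (F := Φ.imdeSum f N τ) (S := S) (τ := τ)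
      (B := ball x (r₀ / 2))
      (Y := fun k => Φ.solver V (fun u => τ • G τ u) 1 k y) (Z := fun k => c k)
      (V := fun k => Φ.stages V (fun u => τ • G τ u) (Φ.solver V (fun u => τ • G τ u) 1 k y))
      (W := fun k i => Φ.formalStage (Φ.imdeCoeff f) (c k) N τ i)
      (ε := C * ‖τ‖ ^ n) (η := C' * ‖τ‖ ^ N)
      (ω := 4 * (C * ‖τ‖ ^ n) / r₀ * (S * (Φ.size * (‖τ‖ * (2 * m))))) (l := l)
      (by positivity) (by positivity) (by positivity) (by positivity)
      (by simpa [solver] using hc.1.symm)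
      (fun k hk => (hspec k hk).1) (fun k hk => (hspec k hk).2)
      (fun k hk => by
        have h4 := hc.norm_sub_exact_le hf (V := ball x r₀)
          (fun r hr => hhalf (hcball r hr).1)
          (fun u hu => (hball₀ _ (hmem₀ hτr₀ hu)).2.2.1) hk
        have h5 := (hball₀ _ (hmem₀ hτr₀ (hhalf (hcball k (hkS k hk)).1))).2.2.2.2.2
        rw [norm_pow] at h5
        have h6 := norm_sub_le_of_le h4 h5
        rw [sub_sub_sub_cancel_right] at h6
        push_cast
        refine h6.trans ?_
        have h7 : 0 ≤ C₁ * ‖τ‖ ^ (N + 1) := by positivity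
        have h8 : ‖τ‖ * (C' * ‖τ‖ ^ N) = C' * ‖τ‖ ^ (N + 1) := by ring
        rw [h8, hC']
        linarith)
      (fun k hk i => by
        have h5 := (hball₀ _ (hmem₀ hτr₀ (hhalf (hcball k (hkS k hk)).1))).2.2.2.2.1
        rw [norm_pow] at h5
        refine ((norm_le_pi_norm _ i).trans h5).trans ?_
        have h7 : 0 ≤ (C₂ + C₃) * ‖τ‖ ^ (N + 1) := by positivity
        have h8 : ‖τ‖ * (C' * ‖τ‖ ^ N) = C' * ‖τ‖ ^ (N + 1) := by ring
        rw [h8, hC']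
        linarith)
      (fun k hk i => (hdrift _ (hVst k hk i)).1)
      (fun k hk i => hball₁ _ (hmem₁ hτr₁ (hcball k (hkS k hk)).2) i)
      (fun u hu => hEbound u (hhalf hu))
      (fun k hk i => by
        refine (hE.norm_sub_le hEbound (hdrift _ (hVst k hk i)).1
          (hdrift y (by rw [sub_self, norm_zero]; positivity)).1).trans ?_
        have := hVst k hk i
        gcongr)
      (fun u hu w hw => hFτ.norm_sub_le hFbound hu hw)
      h2.le
    have hτpos : 0 < ‖τ‖ := norm_pos_iff.2 hτ0
    have hpos : 0 < S * ‖τ‖ := by positivity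
    have hSτ : ((S : ℂ) * τ) ≠ 0 := mul_ne_zero (by exact_mod_cast (by omega : S ≠ 0)) hτ0
    have hnorm : ‖(S : ℂ) * τ‖ = S * ‖τ‖ := by rw [norm_mul, Complex.norm_natCast]
    have heq : ((S : ℂ) * τ) • (Φ.correction U V f S G τ y - Φ.imdeSum f N τ y) =
        -(Φ.solver V (fun u => τ • G τ u) 1 S y - c S -
          (S * τ) • (G τ y - Φ.imdeSum f N τ y)) := by
      rw [correction_eq hτ0 hδ hm hS hGτ (hGm τ hτ) hs1 hyV, hcflow, sub_right_comm, smul_sub,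
        smul_smul, mul_inv_cancel₀ hSτ, one_smul]
      abel
    rw [← mul_le_mul_iff_right₀ hpos]
    calc S * ‖τ‖ * ‖Φ.correction U V f S G τ y - Φ.imdeSum f N τ y‖
        = ‖((S : ℂ) * τ) • (Φ.correction U V f S G τ y - Φ.imdeSum f N τ y)‖ := by
          rw [norm_smul, hnorm]
      _ ≤ S * ‖τ‖ * (Φ.size * (4 * (C * ‖τ‖ ^ n) / r₀ * (S * (Φ.size * (‖τ‖ * (2 * m))))) +
          10 * Φ.size ^ 2 * S * l * ‖τ‖ * (C * ‖τ‖ ^ n + C' * ‖τ‖ ^ N) + C' * ‖τ‖ ^ N) := by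
        rw [heq, norm_neg]
        exact hcomp
      _ ≤ S * ‖τ‖ * (Φ.size * (4 * (C * ‖τ‖ ^ n) / r₀ * (S * (Φ.size * (‖τ‖ * (2 * m))))) +
          10 * Φ.size ^ 2 * S * l * ‖τ‖ * (C * ‖τ‖ ^ n + C' * ‖τ‖ ^ n) +
            C' * ‖τ‖ ^ (n + 1)) := by gcongr
      _ = S * ‖τ‖ * (K * ‖τ‖ ^ (n + 1)) := by rw [hK]; ring
  -- the bound extends to `τ = 0` by continuity
  obtain ⟨r, hr, hball⟩ := Metric.eventually_nhds_iff_ball.1 (hmain.and (eventually_snd_mem hx))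
  refine IsBigO.of_bound K ?_
  filter_upwards [ball_mem_nhds ((0 : ℂ), x) hr] with p hp
  rw [norm_pow]
  rcases ne_or_eq p.1 0 with hτ0 | hτ0
  · exact (hball p hp).1 hτ0
  · have hy : p.2 ∈ V' := (hball p hp).2
    have hcont : ContinuousAt (fun τ => Φ.correction U V f S G τ p.2 - Φ.imdeSum f N τ p.2) 0 := by
      refine ContinuousAt.sub ?_ ?_
      · exact ((holomorphicFamily_correction hδ hm hS hf.holomorphicAlong hfm hG hGm hV hVU hε.le
          hsmall).differentiableOn hy).continuousOn.continuousAt (ball_mem_nhds 0 hε)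
      · unfold imdeSum
        fun_prop
    rw [hτ0]
    have h1 : Tendsto (fun τ : ℂ => ‖Φ.correction U V f S G τ p.2 - Φ.imdeSum f N τ p.2‖)
        (𝓝[≠] 0) (𝓝 ‖Φ.correction U V f S G 0 p.2 - Φ.imdeSum f N 0 p.2‖) :=
      hcont.norm.tendsto.mono_left nhdsWithin_le_nhds
    have h2 : Tendsto (fun τ : ℂ => K * ‖τ‖ ^ (n + 1)) (𝓝[≠] 0) (𝓝 (K * ‖(0 : ℂ)‖ ^ (n + 1))) :=
      ((by fun_prop : Continuous fun τ : ℂ => K * ‖τ‖ ^ (n + 1)).tendsto 0).mono_left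
        nhdsWithin_le_nhds
    refine le_of_tendsto_of_tendsto h1 h2 ?_
    filter_upwards [self_mem_nhdsWithin, nhdsWithin_le_nhds (ball_mem_nhds (0 : ℂ) hr)] with τ h3 h4
    refine (hball (τ, p.2) ?_).1 h3
    rw [← ball_prod_same] at hp ⊢
    exact ⟨h4, hp.2⟩

end Order

end RungeKutta

/-! ### The estimate -/

namespace RungeKutta

variable {s D : ℕ}

theorem imdeTrunc_eq_imdeSum (Φ : RungeKutta s) (f : CVec D → CVec D) (h : ℝ) (K : ℕ)
    (y : CVec D) : Φ.imdeTrunc f h K y = Φ.imdeSum f (K + 1) (h : ℂ) y := by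
  simp only [imdeTrunc, imdeSum, ← Complex.ofReal_pow, Complex.coe_smul]

section Estimate

variable {Φ : RungeKutta s} {U : Set (CVec D)} {f g : CVec D → CVec D} {S N : ℕ}
  {δ ε m r h L : ℝ} {x : CVec D}

/-- The iterates of the correction step, on balls of decreasing radius. The constant `e / (e - 1)`
is the fixed point of `c ↦ c / e + 1`. -/
theorem exists_iterate_correction (hΦ : Φ.Consistent) (hδ : 0 < δ) (hm : 0 < m) (hS : 1 ≤ S)
    (hf : AnalyticOnNhd ℂ f U) (hfm : ∀ u ∈ U, ‖f u‖ ≤ m)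
    (hg : AnalyticOnNhd ℂ g U) (hgm : ∀ u ∈ U, ‖g u‖ ≤ m)
    (hε : 0 < ε) (hsmall : 300 * Φ.size ^ 2 * S * (ε * m) ≤ δ) (hh : 0 < h) (hhε : h < ε)
    (hrU : ∀ y ∈ ball x r, ball y δ ⊆ U) (hNr : (N + 1) * δ ≤ r) (hL : 0 ≤ L)
    (hloss : ∀ y ∈ ball x r, ‖Φ.solver U (fun u => (h : ℂ) • g u) 1 S y -
      flow U (fun u => (h : ℂ) • f u) S y‖ / (S * ‖(h : ℂ)‖) ≤ L) {n : ℕ} (hn : n ≤ N) :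
    ∃ G : ℂ → CVec D → CVec D,
      HolomorphicFamily ε (ball x ((N + 1 - n) * δ)) G ∧
      (∀ τ ∈ ball (0 : ℂ) ε, ∀ u ∈ ball x ((N + 1 - n) * δ), ‖G τ u‖ ≤ 2 * m) ∧
      (∀ u ∈ ball x ((N + 1 - n) * δ), ‖g u - G h u‖ ≤
        (Real.exp 1)⁻¹ ^ n * m + Real.exp 1 / (Real.exp 1 - 1) * L) ∧
      (fun p : ℂ × CVec D => G p.1 p.2 - Φ.imdeSum f N p.1 p.2) =O[𝓝 (0, x)]
        fun p => p.1 ^ n := by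
  have he : 1 < Real.exp 1 := by linarith [Real.exp_one_gt_d9]
  have hsub : ∀ n : ℕ, ball x ((N + 1 - n) * δ) ⊆ U := by
    intro n u hu
    refine hrU u (ball_subset_ball ?_ hu) (mem_ball_self hδ)
    refine le_trans ?_ hNr
    gcongr
    linarith [n.cast_nonneg (α := ℝ)]
  induction n with
  | zero =>
    refine ⟨fun _ _ => 0, fun W τ u _ _ _ _ _ => differentiableOn_const 0, fun _ _ _ _ => ?_,
      fun u hu => ?_, ?_⟩
    · simp only [norm_zero]
      positivity
    · have : 0 ≤ Real.exp 1 / (Real.exp 1 - 1) * L :=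
        mul_nonneg (div_nonneg (by linarith) (by linarith)) hL
      rw [sub_zero, pow_zero, one_mul]
      linarith [hgm u (hsub 0 hu)]
    · have hx : x ∈ U := hsub 0 (mem_ball_self (by push_cast; nlinarith [N.cast_nonneg (α := ℝ)]))
      have := (analyticAt_imdeSum hf N (Φ := Φ) (p := ((0 : ℂ), x)) hx).continuousAt.tendsto
      simpa using this.isBigO_one ℂ
  | succ n ih =>
    obtain ⟨G, hG, hGm, hGg, hGO⟩ := ih (by omega)
    have hnN : (n : ℝ) + 1 ≤ N := by exact_mod_cast hn
    have hV : ∀ y ∈ ball x ((N + 1 - (n + 1 : ℕ)) * δ), ball y δ ⊆ ball x ((N + 1 - n) * δ) := by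
      intro y hy
      refine ball_subset_ball' ?_
      rw [mem_ball] at hy
      push_cast at hy
      linarith
    have hhball : (h : ℂ) ∈ ball (0 : ℂ) ε := by
      rwa [mem_ball_zero_iff, Complex.norm_real, Real.norm_of_nonneg hh.le]
    refine ⟨Φ.correction U (ball x ((N + 1 - n) * δ)) f S G,
      holomorphicFamily_correction hδ hm hS hf.holomorphicAlong hfm hG hGm hV (hsub n) hε.le hsmall,
      fun τ hτ u hu => norm_correction_le hΦ hδ hm hS hf.holomorphicAlong hfm hG hGm hV (hsub n)
        hsmall hτ hu, fun u hu => ?_, ?_⟩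
    · have h1 := norm_sub_correction_le (f := f) hΦ hδ hm hS hg.holomorphicAlong hgm hG hGm hV
        (hsub n) hsmall (Complex.ofReal_ne_zero.2 hh.ne') hhball hGg hu
      have hur : u ∈ ball x r := by
        refine ball_subset_ball ?_ hu
        refine le_trans ?_ hNr
        gcongr
        linarith [(n + 1).cast_nonneg (α := ℝ)]
      refine (h1.trans (add_le_add le_rfl (hloss u hur))).trans_eq ?_
      have he1 : Real.exp 1 - 1 ≠ 0 := by linarith
      have hfix : (Real.exp 1)⁻¹ * (Real.exp 1 / (Real.exp 1 - 1)) + 1 =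
          Real.exp 1 / (Real.exp 1 - 1) := by
        field_simp
        ring
      linear_combination L * hfix
    · refine isBigO_correction_sub hΦ hδ hm hS hf hfm hG hGm hV (hsub n) hε hsmall
        (ball_mem_nhds x ?_) (by omega) hGO
      push_cast
      nlinarith

/-- The estimate in terms of the number `N` of correction steps: the first term on the right collects
the contracted initial distance and the Taylor remainder. -/
theorem norm_sub_imdeSum_le (hΦ : Φ.Consistent) (hδ : 0 < δ) (hm : 0 < m) (hS : 1 ≤ S)
    (hf : AnalyticOnNhd ℂ f U) (hfm : ∀ u ∈ U, ‖f u‖ ≤ m)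
    (hg : AnalyticOnNhd ℂ g U) (hgm : ∀ u ∈ U, ‖g u‖ ≤ m)
    (hε : 0 < ε) (hsmall : 300 * Φ.size ^ 2 * S * (ε * m) ≤ δ) (hh : 0 < h)
    (hhε : h ≤ (Real.exp 1)⁻¹ * ε)
    (hrU : ∀ y ∈ ball x r, ball y δ ⊆ U) (hNr : (N + 1) * δ ≤ r) (hL : 0 ≤ L)
    (hloss : ∀ y ∈ ball x r, ‖Φ.solver U (fun u => (h : ℂ) • g u) 1 S y -
      flow U (fun u => (h : ℂ) • f u) S y‖ / (S * ‖(h : ℂ)‖) ≤ L) :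
    ‖g x - Φ.imdeSum f N h x‖ ≤
      5 * m * Real.exp (-N) + Real.exp 1 / (Real.exp 1 - 1) * L := by
  have hexp : (Real.exp 1)⁻¹ ≤ 1 / 2 := by
    rw [inv_le_comm₀ (Real.exp_pos 1) (by norm_num)]
    linarith [Real.exp_one_gt_d9]
  have hhlt : h < ε := by nlinarith
  have hexpN : Real.exp (-N) = (Real.exp 1)⁻¹ ^ N := by
    rw [← Real.exp_neg, ← Real.exp_nat_mul, mul_neg, mul_one]
  obtain ⟨G, hG, hGm, hGg, hGO⟩ := exists_iterate_correction hΦ hδ hm hS hf hfm hg hgm hε hsmall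
    hh hhlt hrU hNr hL hloss le_rfl
  have hx : x ∈ ball x (((N : ℝ) + 1 - N) * δ) := mem_ball_self (by ring_nf; exact hδ)
  have hd := hG.differentiableOn hx
  -- the Taylor polynomial of the last iterate is the truncated inverse modified field
  have hcoeff : ∀ k < N, taylorCoeff k (fun τ => G τ x) = Φ.imdeCoeff f k x := fun k hk =>
    taylorCoeff_eq_of_isBigO (c := fun k => Φ.imdeCoeff f k x)
      (hd.analyticAt (ball_mem_nhds 0 hε)) (hGO.comp_tendsto tendsto_prodMk_nhds_zero) hk
  have hhball : (h : ℂ) ∈ ball (0 : ℂ) ε := by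
    rwa [mem_ball_zero_iff, Complex.norm_real, Real.norm_of_nonneg hh.le]
  have htail := norm_sub_taylor_le hd (fun τ hτ => hGm τ hτ x hx) N hhball
  rw [Finset.sum_congr rfl fun k hk => by rw [hcoeff k (Finset.mem_range.1 hk)], Complex.norm_real,
    Real.norm_of_nonneg hh.le] at htail
  have hq : h / ε ≤ (Real.exp 1)⁻¹ := (div_le_iff₀ hε).2 hhε
  have htail' : ‖G h x - Φ.imdeSum f N h x‖ ≤ 4 * m * (Real.exp 1)⁻¹ ^ N := by
    refine htail.trans ?_
    rw [div_le_iff₀ (by linarith)]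
    have h1 : (h / ε) ^ N ≤ (Real.exp 1)⁻¹ ^ N := by gcongr
    have h2 : 0 ≤ 2 * m * (Real.exp 1)⁻¹ ^ N := by positivity
    nlinarith
  calc ‖g x - Φ.imdeSum f N h x‖ ≤ ‖g x - G h x‖ + ‖G h x - Φ.imdeSum f N h x‖ :=
        norm_sub_le_norm_sub_add_norm_sub _ _ _
    _ ≤ ((Real.exp 1)⁻¹ ^ N * m + Real.exp 1 / (Real.exp 1 - 1) * L) +
        4 * m * (Real.exp 1)⁻¹ ^ N := add_le_add (hGg x hx) htail'
    _ = _ := by rw [hexpN]; ring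

/-- For small steps the solver and the flow are defined, and the error is bounded. -/
theorem wellDefined_and_pointLoss_le (hδ : 0 < δ) (hm : 0 < m) (hS : 1 ≤ S)
    (hf : AnalyticOnNhd ℂ f U) (hfm : ∀ u ∈ U, ‖f u‖ ≤ m)
    (hg : AnalyticOnNhd ℂ g U) (hgm : ∀ u ∈ U, ‖g u‖ ≤ m) (hh : 0 < h)
    (hsmall : 300 * Φ.size ^ 2 * S * (h * m) ≤ δ) {y : CVec D} (hyU : ball y δ ⊆ U) :
    Φ.SolverDefinedAt U g h S y ∧ FlowDefinedAt U f (S * h) y ∧ pointLoss Φ U f g h S y ≤ 2 * δ ∧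
      pointLoss Φ U f g h S y = ‖Φ.solver U (fun u => (h : ℂ) • g u) 1 S y -
        flow U (fun u => (h : ℂ) • f u) S y‖ := by
  have hnorm : ‖(h : ℂ)‖ = h := by rw [Complex.norm_real, Real.norm_of_nonneg hh.le]
  obtain ⟨-, hs2, hs3, -⟩ := step_size_bounds hδ hm hS hsmall hh.le le_rfl
  rw [← hnorm] at hs2 hs3
  have hspec := fun k (hk : k ≤ S) => solver_spec hδ (by positivity) hyU
    (hg.holomorphicAlong.const_smul (h : ℂ)) (norm_smul_field_le hgm (h : ℂ)) hS hs2 hk (Φ := Φ)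
  have hflow : FlowDefinedAt U f (S * h) y := by
    refine flowDefinedAt_of_bound hδ hm.le (by positivity) hyU (hf.holomorphicAlong.mono hyU)
      hfm ?_
    rw [hnorm] at hs3
    have : 0 ≤ S * (h * m) := by positivity
    linarith
  have hflow' : FlowDefinedAt U (fun u => (h : ℂ) • f u) S y :=
    flowDefinedAt_smul hδ hm.le hyU hf.holomorphicAlong hfm hs3
  have heq : pointLoss Φ U f g h S y = ‖Φ.solver U (fun u => (h : ℂ) • g u) 1 S y -
      flow U (fun u => (h : ℂ) • f u) S y‖ := by
    rw [pointLoss, solver_smul, flow_rescale hh (by positivity) hflow hflow']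
  refine ⟨?_, hflow, ?_, heq⟩
  · rw [← solverDefinedAt_smul_iff]
    exact fun k hk => (hspec k hk.le).2.2
  · obtain ⟨c, hc⟩ := hflow'.1
    have h1 := (hspec S le_rfl).1
    have h2 := hc.mem_closedBall (by positivity) (norm_smul_field_le hfm (h : ℂ))
      (Set.right_mem_Icc.2 (Nat.cast_nonneg S))
    rw [← hflow'.flow_eq (by positivity) hc, mem_closedBall_iff_norm] at h2
    rw [heq]
    calc _ = ‖(Φ.solver U (fun u => (h : ℂ) • g u) 1 S y - y) -
          (flow U (fun u => (h : ℂ) • f u) S y - y)‖ := by congr 1; abel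
      _ ≤ S * (Φ.size * (‖(h : ℂ)‖ * m)) + ‖(h : ℂ)‖ * m * S := norm_sub_le_of_le h1 h2
      _ ≤ 2 * δ := by linarith

end Estimate

end RungeKutta

end IMDE

theorem theorem3p1 {s : ℕ} (Φ : IMDE.RungeKutta s) (hΦ : Φ.Consistent) (S : ℕ) (hS : 1 ≤ S)
    (ρ₁ ρ₂ : ℝ) (hρ₁ : 0 < ρ₁) (hρ₂ : 0 < ρ₂) :
    ∃ T₀ q γ c₁ : ℝ, 0 < T₀ ∧ 0 < q ∧ 0 < γ ∧ 0 < c₁ ∧ ∃ K : ℝ → ℕ,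
      ∀ (D : ℕ) (x : Fin D → ℝ) (r₁ r₂ m : ℝ), 0 < r₁ → 0 < r₂ → 0 < m →
        r₁ / m = ρ₁ → r₂ / m = ρ₂ →
      ∀ (U : Set (IMDE.CVec D)), U = Metric.ball (IMDE.ofRealVec x) (r₁ + r₂) →
      ∀ (f fθ : IMDE.CVec D → IMDE.CVec D),
        AnalyticOnNhd ℂ f U → (∀ y ∈ U, ‖f y‖ ≤ m) →
        AnalyticOnNhd ℂ fθ U → (∀ y ∈ U, ‖fθ y‖ ≤ m) →
      ∀ T h : ℝ, 0 < T → T < T₀ → h = T / S →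
        -- the loss is meaningful: solver and flow are well defined on `B(x, r₁)`, with finite loss
        (∀ y ∈ Metric.ball (IMDE.ofRealVec x) r₁,
          Φ.SolverDefinedAt U fθ h S y ∧ IMDE.FlowDefinedAt U f (S * h) y) ∧
        BddAbove (IMDE.pointLoss Φ U f fθ h S '' Metric.ball (IMDE.ofRealVec x) r₁) ∧
        -- the estimate
        ‖fθ (IMDE.ofRealVec x) - Φ.imdeTrunc f h (K h) (IMDE.ofRealVec x)‖ ≤
          c₁ * m * Real.exp (-γ / h ^ (1 / q))
            + Real.exp 1 / (Real.exp 1 - 1) *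
              IMDE.loss Φ U f fθ h S (IMDE.ofRealVec x) r₁ := by
  set A := Φ.size with hA
  have hA1 : 1 ≤ A := Φ.one_le_size
  have hS' : (1 : ℝ) ≤ S := by exact_mod_cast hS
  set ρ := min ρ₁ ρ₂ with hρ
  have hρ0 : 0 < ρ := lt_min hρ₁ hρ₂
  set κ := 300 * A ^ 2 * S with hκ
  have hκ0 : 0 < κ := by positivity
  have he := Real.exp_pos 1
  -- with `N + 1 = ⌊a / h⌋` iterations, the step size satisfies `h ≤ ρ / (κ (N + 1)) / e`
  set a := ρ / κ / Real.exp 1 with ha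
  have ha0 : 0 < a := by positivity
  refine ⟨a / 2, 1, a, 5 * Real.exp 2, by positivity, one_pos, ha0, by positivity,
    fun h => ⌊a / h⌋₊ - 2, ?_⟩
  intro D x r₁ r₂ m hr₁ hr₂ hm h1 h2 U hU f fθ hf hfm hg hgm T h hT hTT₀ hhT
  have hh : 0 < h := by rw [hhT]; positivity
  have hhT' : h ≤ T := by rw [hhT]; exact div_le_self hT.le hS'
  have hah : 2 ≤ a / h := by rw [le_div_iff₀ hh]; linarith
  have hfloor : 2 ≤ ⌊a / h⌋₊ := Nat.le_floor (by exact_mod_cast hah)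
  obtain ⟨K, hK⟩ : ∃ K, ⌊a / h⌋₊ = K + 2 := ⟨⌊a / h⌋₊ - 2, by omega⟩
  have hKle : (K : ℝ) + 2 ≤ a / h := by
    have := Nat.floor_le (show 0 ≤ a / h by positivity)
    rw [hK] at this
    exact_mod_cast this
  have hKlt : a / h < K + 3 := by
    have := Nat.lt_floor_add_one (a / h)
    rw [hK] at this
    push_cast at this
    linarith
  set δ := ρ * m / (K + 2) with hδ
  set ε := δ / (κ * m) with hε
  have hK2 : (0 : ℝ) < K + 2 := by positivity
  have hδ0 : 0 < δ := by positivity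
  have hε0 : 0 < ε := by positivity
  have hsmall : 300 * Φ.size ^ 2 * S * (ε * m) ≤ δ := by
    rw [← hA, ← hκ, hε]
    apply le_of_eq
    field_simp
  have hhε : h ≤ (Real.exp 1)⁻¹ * ε := by
    have : h ≤ a / (K + 2) := by
      rw [le_div_iff₀ hK2, mul_comm]
      exact (le_div_iff₀ hh).1 hKle
    refine this.trans_eq ?_
    rw [ha, hε, hδ]
    field_simp
  have hhε' : h ≤ ε := by
    refine hhε.trans (mul_le_of_le_one_left hε0.le ?_)
    exact inv_le_one_of_one_le₀ (by linarith [Real.exp_one_gt_d9])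
  have hsmall' : 300 * Φ.size ^ 2 * S * (h * m) ≤ δ := by
    refine le_trans ?_ hsmall
    gcongr
  have hρ₁m : ρ * m ≤ r₁ := by
    have : ρ ≤ r₁ / m := by rw [h1]; exact min_le_left _ _
    exact (le_div_iff₀ hm).1 this
  have hρ₂m : ρ * m ≤ r₂ := by
    have : ρ ≤ r₂ / m := by rw [h2]; exact min_le_right _ _
    exact (le_div_iff₀ hm).1 this
  have hδr₂ : δ ≤ r₂ := by
    refine le_trans ?_ hρ₂m
    exact div_le_self (by positivity) (by linarith [K.cast_nonneg (α := ℝ)])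
  have hrU : ∀ y ∈ Metric.ball (IMDE.ofRealVec x) r₁, Metric.ball y δ ⊆ U := by
    intro y hy
    rw [hU]
    refine Metric.ball_subset_ball' ?_
    rw [Metric.mem_ball] at hy
    linarith
  have hwell := fun y hy => IMDE.RungeKutta.wellDefined_and_pointLoss_le hδ0 hm hS hf hfm hg hgm hh
    hsmall' (hrU y hy) (Φ := Φ)
  have hbdd : BddAbove (IMDE.pointLoss Φ U f fθ h S '' Metric.ball (IMDE.ofRealVec x) r₁) := by
    refine ⟨2 * δ, ?_⟩
    rintro _ ⟨y, hy, rfl⟩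
    exact (hwell y hy).2.2.1
  refine ⟨fun y hy => ⟨(hwell y hy).1, (hwell y hy).2.1⟩, hbdd, ?_⟩
  have hlossle : ∀ y ∈ Metric.ball (IMDE.ofRealVec x) r₁,
      ‖Φ.solver U (fun u => (h : ℂ) • fθ u) 1 S y -
        IMDE.flow U (fun u => (h : ℂ) • f u) S y‖ / (S * ‖(h : ℂ)‖) ≤
          IMDE.loss Φ U f fθ h S (IMDE.ofRealVec x) r₁ := by
    intro y hy
    rw [← (hwell y hy).2.2.2, Complex.norm_real, Real.norm_of_nonneg hh.le, IMDE.loss]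
    gcongr
    refine le_ciSup (f := fun y : Metric.ball (IMDE.ofRealVec x) r₁ =>
      IMDE.pointLoss Φ U f fθ h S y) ?_ ⟨y, hy⟩
    rwa [Set.image_eq_range] at hbdd
  have hL0 : 0 ≤ IMDE.loss Φ U f fθ h S (IMDE.ofRealVec x) r₁ :=
    le_trans (by positivity) (hlossle _ (Metric.mem_ball_self hr₁))
  have hest := IMDE.RungeKutta.norm_sub_imdeSum_le (N := K + 1) hΦ hδ0 hm hS hf hfm hg hgm hε0
    hsmall hh hhε hrU ?_ hL0 hlossle
  swap
  · have : ((K + 1 : ℕ) : ℝ) + 1 = K + 2 := by push_cast; ring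
    rw [this, hδ, mul_div_cancel₀ _ hK2.ne']
    exact hρ₁m
  have hKh : ⌊a / h⌋₊ - 2 = K := by omega
  simp only [hKh]
  rw [IMDE.RungeKutta.imdeTrunc_eq_imdeSum]
  refine hest.trans (add_le_add ?_ le_rfl)
  have hexp : Real.exp (-((K + 1 : ℕ) : ℝ)) ≤ Real.exp 2 * Real.exp (-a / h) := by
    rw [← Real.exp_add]
    refine Real.exp_le_exp.2 ?_
    rw [neg_div]
    push_cast
    linarith
  rw [div_one, Real.rpow_one]
  calc 5 * m * Real.exp (-((K + 1 : ℕ) : ℝ)) ≤ 5 * m * (Real.exp 2 * Real.exp (-a / h)) := by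
        gcongr
    _ = 5 * Real.exp 2 * m * Real.exp (-a / h) := by ring
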